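/- Let $0\le k\le n$ be integers and let $s_1,\dots,s_{n-1}$ be the simple reflections of the symmetric group $\mathbb S_n$, with length function $\ell$ and Bruhat order $\prec$. Let $\mathcal H_n$ be the unital associative $\mathbb C(v)$-algebra generated by $H_1,\dots,H_{n-1}$ with relations $H_iH_j=H_jH_i$ for $|i-j|>1$, $H_iH_{i+1}H_i=H_{i+1}H_iH_{i+1}$ and $H_i^2=(v^{-1}-v)H_i+1$. For $w\in\mathbb S_n$ put $H_w=H_{i_1}\cdots H_{i_r}$ for any reduced expression $w=s_{i_1}\cdots s_{i_r}$. The bar involution is the $\mathbb C$-linear ring involution of $\mathcal H_n$ with $\overline v=v^{-1}$ and $\overline{H_w}=H_{w^{-1}}^{-1}$. Let $\{C_w\}_{w\in\mathbb S_n}$ be the Kazhdan--Lusztig basis, that is, the unique $\mathbb C(v)$-basis of $\mathcal H_n$ consisting of bar-invariant elements such that $C_w\in H_w+\sum_{w'\prec w}v\mathbb Z[v]H_{w'}$. Let $W_k=\langle s_1,\dots,s_{k-1}\rangle$ (identified with $\mathbb S_k$) and $W_k^\perp=\langle s_{k+1},\dots,s_{n-1}\rangle$, let $w_k$ be the longest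 element of $W_k$, and let $D$ be the set of shortest representatives of the cosets $(W_k\times W_k^\perp)\backslash\mathbb S_n$. Identify $z\in D$ with the $\wedge\vee$-sequence obtained from $\wedge^k\vee^{n-k}$ by the right action of $z$ on positions, and for $k+1\le i\le n$ let $z^\vee_i$ be $i$ minus the position, counted from the left, of the $(i-k)$-th $\vee$ of $z$. For $k+1\le j\le n$ and $0\le l\le k$ let $t^\vee_{j,l}=s_{j-1}s_{j-2}\cdots s_{j-l}$, with $t^\vee_{j,0}=e$. Then for every $z\in D$ one has $z=t^\vee_{k+1,z^\vee_{k+1}}\cdots t^\vee_{n,z^\vee_n}$, and $$C_{w_kz}=\sum_{w'\in\mathbb S_k}\ \sum_{i_{k+1}=0}^{z^\vee_{k+1}}\cdots\sum_{i_n=0}^{z^\vee_n} v^{\,\ell(w_kz)-\ell(w')-(i_{k+1}+\cdots+i_n)}\,H_{w'\,t^\vee_{k+1,i_{k+1}}\cdots t^\vee_{n,i_n}}.$$ -/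

import Mathlib

namespace SymHecke

/-! ### The symmetric group with its simple reflections

Positions `1, …, n` are the elements of `Fin n` (position `p` is the element with value `p - 1`).
Indices of simple reflections are the natural numbers `1, …, n - 1`. -/

/-- The index set `{1, …, n - 1}` of the simple reflections. -/
abbrev SimpleIdx (n : ℕ) : Type := {i : ℕ // 1 ≤ i ∧ i < n}

/-- The simple reflection `s_i`, exchanging the positions `i` and `i + 1`. -/
def simple {n : ℕ} (i : SimpleIdx n) : Equiv.Perm (Fin n) :=
  Equiv.swap ⟨i.1 - 1, lt_of_le_of_lt (Nat.sub_le _ _) i.2.2⟩ ⟨i.1, i.2.2⟩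

/-- The product `s_{i_1} ⋯ s_{i_r}` of a word in the simple reflections. -/
def wordProd {n : ℕ} (l : List (SimpleIdx n)) : Equiv.Perm (Fin n) :=
  (l.map simple).prod

theorem exists_word {n : ℕ} (w : Equiv.Perm (Fin n)) :
    ∃ l : List (SimpleIdx n), wordProd l = w := by
  cases n with
  | zero => exact ⟨[], Subsingleton.elim _ _⟩
  | succ m =>
    have hw : w ∈ Submonoid.closure
        (Set.range fun i : Fin m => Equiv.swap i.castSucc i.succ) := by
      rw [Equiv.Perm.mclosure_swap_castSucc_succ]; trivial
    induction hw using Submonoid.closure_induction with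
    | mem x hx =>
      obtain ⟨i, rfl⟩ := hx
      refine ⟨[⟨i.1 + 1, by omega, by omega⟩], ?_⟩
      simp only [wordProd, simple, List.map_cons, List.map_nil, List.prod_cons, List.prod_nil,
        mul_one]
      congr 1
    | one => exact ⟨[], rfl⟩
    | mul x y _ _ hx hy =>
      obtain ⟨a, rfl⟩ := hx
      obtain ⟨b, rfl⟩ := hy
      exact ⟨a ++ b, by simp [wordProd]⟩

/-- The length `ℓ(w)`: the least number of simple reflections with product `w`. -/
noncomputable def len {n : ℕ} (w : Equiv.Perm (Fin n)) : ℕ :=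
  sInf {r | ∃ l : List (SimpleIdx n), l.length = r ∧ wordProd l = w}

/-- `l` is a reduced expression of `w`. -/
def IsReducedWord {n : ℕ} (l : List (SimpleIdx n)) (w : Equiv.Perm (Fin n)) : Prop :=
  wordProd l = w ∧ l.length = len w

theorem exists_reducedWord {n : ℕ} (w : Equiv.Perm (Fin n)) :
    ∃ l : List (SimpleIdx n), IsReducedWord l w := by
  have hne : {r | ∃ l : List (SimpleIdx n), l.length = r ∧ wordProd l = w}.Nonempty := by
    obtain ⟨l, hl⟩ := exists_word w
    exact ⟨l.length, l, rfl, hl⟩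
  obtain ⟨l, hl, hw⟩ := Nat.sInf_mem hne
  exact ⟨l, hw, hl⟩

/-- The strict Bruhat order: the transitive closure of the relation `u → u t` for transpositions
`t` (the reflections of the symmetric group) with `ℓ(u) < ℓ(u t)`. -/
def BruhatLT {n : ℕ} : Equiv.Perm (Fin n) → Equiv.Perm (Fin n) → Prop :=
  Relation.TransGen fun u w => ∃ t : Equiv.Perm (Fin n), t.IsSwap ∧ w = u * t ∧ len u < len w

/-! ### The Hecke algebra -/

/-- The field `ℂ(v)`. -/
abbrev K : Type := RatFunc ℂ

/-- The variable `v`. -/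
noncomputable abbrev v : K := RatFunc.X

/-- The defining relations of the Hecke algebra (Soergel's normalization). -/
inductive HeckeRel (n : ℕ) : FreeAlgebra K (SimpleIdx n) → FreeAlgebra K (SimpleIdx n) → Prop
  | comm (i j : SimpleIdx n) (h : 1 < |(i.1 : ℤ) - (j.1 : ℤ)|) :
      HeckeRel n (FreeAlgebra.ι K i * FreeAlgebra.ι K j) (FreeAlgebra.ι K j * FreeAlgebra.ι K i)
  | braid (i j : SimpleIdx n) (h : j.1 = i.1 + 1) :
      HeckeRel n (FreeAlgebra.ι K i * FreeAlgebra.ι K j * FreeAlgebra.ι K i)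
        (FreeAlgebra.ι K j * FreeAlgebra.ι K i * FreeAlgebra.ι K j)
  | quad (i : SimpleIdx n) :
      HeckeRel n (FreeAlgebra.ι K i * FreeAlgebra.ι K i)
        ((v⁻¹ - v) • FreeAlgebra.ι K i + 1)

/-- The Hecke algebra of the symmetric group `S_n` over `ℂ(v)`. -/
def Hecke (n : ℕ) : Type := RingQuot (HeckeRel n)

noncomputable instance (n : ℕ) : Ring (Hecke n) := inferInstanceAs (Ring (RingQuot (HeckeRel n)))

noncomputable instance (n : ℕ) : Algebra K (Hecke n) :=
  inferInstanceAs (Algebra K (RingQuot (HeckeRel n)))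

/-- The quotient map from the free algebra. -/
noncomputable def toHecke (n : ℕ) : FreeAlgebra K (SimpleIdx n) →ₐ[K] Hecke n :=
  RingQuot.mkAlgHom K (HeckeRel n)

theorem toHecke_rel {n : ℕ} {x y : FreeAlgebra K (SimpleIdx n)} (h : HeckeRel n x y) :
    toHecke n x = toHecke n y :=
  RingQuot.mkAlgHom_rel K h

/-- The generator `H_i`. -/
noncomputable def gen {n : ℕ} (i : SimpleIdx n) : Hecke n :=
  toHecke n (FreeAlgebra.ι K i)

/-- The standard basis element `H_w = H_{i_1} ⋯ H_{i_r}`, for a reduced expression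
`w = s_{i_1} ⋯ s_{i_r}` (the product does not depend on which one is chosen). -/
noncomputable def stdBasis {n : ℕ} (w : Equiv.Perm (Fin n)) : Hecke n :=
  ((exists_reducedWord w).choose.map gen).prod

theorem gen_comm {n : ℕ} (i j : SimpleIdx n) (h : 1 < |(i.1 : ℤ) - (j.1 : ℤ)|) :
    gen i * gen j = gen j * gen i := by
  simpa [gen] using toHecke_rel (HeckeRel.comm i j h)

theorem gen_braid {n : ℕ} (i j : SimpleIdx n) (h : j.1 = i.1 + 1) :
    gen i * gen j * gen i = gen j * gen i * gen j := by
  simpa [gen] using toHecke_rel (HeckeRel.braid i j h)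

theorem gen_quad {n : ℕ} (i : SimpleIdx n) :
    gen i * gen i = (v⁻¹ - v) • gen i + 1 := by
  simpa [gen] using toHecke_rel (HeckeRel.quad i)

/-! ### The bar involution -/

theorem v_ne_zero : (v : K) ≠ 0 := RatFunc.X_ne_zero

theorem transcendental_v_inv : Transcendental ℂ (v⁻¹ : K) := by
  intro h
  have h1 : IsAlgebraic ℂ (v : K) := by simpa using h.inv
  have h2 : Transcendental ℂ (algebraMap (Polynomial ℂ) K Polynomial.X) :=
    (transcendental_algebraMap_iff (RatFunc.algebraMap_injective ℂ)).2
      (Polynomial.transcendental_X ℂ)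
  rw [RatFunc.algebraMap_X] at h2
  exact h2 h1

/-- The field endomorphism of `ℂ(v)` over `ℂ` with `v ↦ v⁻¹`. -/
noncomputable def conj : K →ₐ[ℂ] K :=
  (IntermediateField.val _).comp
    (RatFunc.algEquivOfTranscendental (v⁻¹ : K) transcendental_v_inv).toAlgHom

theorem conj_v : conj v = v⁻¹ := by
  simp [conj]

/-- The element `H_i + v - v⁻¹`, the inverse of `H_i`. -/
noncomputable def genInv {n : ℕ} (i : SimpleIdx n) : Hecke n :=
  gen i + (v - v⁻¹) • (1 : Hecke n)

theorem gen_mul_genInv {n : ℕ} (i : SimpleIdx n) : gen i * genInv i = 1 := by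
  rw [genInv, mul_add, gen_quad, mul_smul_comm, mul_one, ← neg_sub v v⁻¹, neg_smul]
  abel

theorem genInv_mul_gen {n : ℕ} (i : SimpleIdx n) : genInv i * gen i = 1 := by
  rw [genInv, add_mul, gen_quad, smul_mul_assoc, one_mul, ← neg_sub v v⁻¹, neg_smul]
  abel

/-- The invertible element `H_i`. -/
noncomputable def genUnit {n : ℕ} (i : SimpleIdx n) : (Hecke n)ˣ :=
  ⟨gen i, genInv i, gen_mul_genInv i, genInv_mul_gen i⟩

/-- The `ℂ(v)`-algebra structure on the Hecke algebra in which `v` acts as `v⁻¹`. -/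
noncomputable abbrev twistedAlgebra (n : ℕ) : Algebra K (Hecke n) :=
  RingHom.toAlgebra' ((algebraMap K (Hecke n)).comp conj.toRingHom)
    (fun c x => Algebra.commutes (conj c) x)

/-- The ring homomorphism underlying `FreeAlgebra.lift`, for an explicit algebra structure. -/
noncomputable def freeLift {X A : Type} [Ring A] (inst : Algebra K A) (f : X → A) :
    FreeAlgebra K X →+* A :=
  (FreeAlgebra.lift K f : FreeAlgebra K X →ₐ[K] A).toRingHom

theorem freeLift_ι {X A : Type} [Ring A] (inst : Algebra K A) (f : X → A) (x : X) :
    freeLift inst f (FreeAlgebra.ι K x) = f x :=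
  FreeAlgebra.lift_ι_apply f x

theorem freeLift_algebraMap {X A : Type} [Ring A] (inst : Algebra K A) (f : X → A) (c : K) :
    freeLift inst f (algebraMap K _ c) = algebraMap K A c :=
  (FreeAlgebra.lift K f : FreeAlgebra K X →ₐ[K] A).commutes c

/-- The ring homomorphism from the free algebra with `v ↦ v⁻¹` and `H_i ↦ H_i⁻¹`. -/
noncomputable def barFree (n : ℕ) : FreeAlgebra K (SimpleIdx n) →+* Hecke n :=
  freeLift (twistedAlgebra n) genInv

theorem barFree_ι {n : ℕ} (i : SimpleIdx n) : barFree n (FreeAlgebra.ι K i) = genInv i :=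
  freeLift_ι (twistedAlgebra n) genInv i

theorem barFree_algebraMap {n : ℕ} (c : K) :
    barFree n (algebraMap K _ c) = algebraMap K (Hecke n) (conj c) :=
  freeLift_algebraMap (twistedAlgebra n) genInv c

theorem barFree_rel {n : ℕ} ⦃x y : FreeAlgebra K (SimpleIdx n)⦄ (h : HeckeRel n x y) :
    barFree n x = barFree n y := by
  cases h with
  | comm i j h =>
    simp only [map_mul, barFree_ι]
    have hu : genUnit j * genUnit i = genUnit i * genUnit j :=
      Units.ext (gen_comm i j h).symm
    have := congrArg (fun u : (Hecke n)ˣ => ((u⁻¹ : (Hecke n)ˣ) : Hecke n)) hu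
    simp only [mul_inv_rev, Units.val_mul] at this
    exact this
  | braid i j h =>
    simp only [map_mul, barFree_ι]
    have hu : genUnit i * genUnit j * genUnit i = genUnit j * genUnit i * genUnit j :=
      Units.ext (gen_braid i j h)
    have := congrArg (fun u : (Hecke n)ˣ => ((u⁻¹ : (Hecke n)ˣ) : Hecke n)) hu
    simp only [mul_inv_rev, Units.val_mul, ← mul_assoc] at this
    exact this
  | quad i =>
    rw [Algebra.smul_def]
    simp only [map_mul, map_add, map_one, barFree_ι, barFree_algebraMap]
    rw [← Algebra.smul_def, map_sub, map_inv₀, conj_v, inv_inv]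
    have h1 : genInv i * genInv i = genInv i * gen i + (v - v⁻¹) • genInv i := by
      conv_lhs => enter [2]; rw [genInv]
      rw [mul_add, mul_smul_comm, mul_one]
    rw [h1, genInv_mul_gen, add_comm]

/-- The bar involution: the ring endomorphism of the Hecke algebra with `v ↦ v⁻¹` and
`H_i ↦ H_i⁻¹`, so that it sends `H_w` to the inverse of `H_{w⁻¹}`. -/
noncomputable def bar (n : ℕ) : Hecke n →+* Hecke n :=
  RingQuot.lift ⟨barFree n, barFree_rel⟩

theorem bar_toHecke {n : ℕ} (x : FreeAlgebra K (SimpleIdx n)) :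
    bar n (toHecke n x) = barFree n x := by
  have h : toHecke n x = RingQuot.mkRingHom (HeckeRel n) x :=
    RingHom.congr_fun (RingQuot.mkAlgHom_coe K (HeckeRel n)) x
  rw [h]
  exact RingQuot.lift_mkRingHom_apply _ _ _

theorem bar_gen {n : ℕ} (i : SimpleIdx n) : bar n (gen i) = genInv i :=
  (bar_toHecke _).trans (barFree_ι i)

theorem bar_algebraMap {n : ℕ} (c : K) :
    bar n (algebraMap K (Hecke n) c) = algebraMap K (Hecke n) (conj c) := by
  rw [← AlgHom.commutes (toHecke n) c, bar_toHecke, barFree_algebraMap]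

/-! ### The Kazhdan–Lusztig basis -/

open Classical in
/-- `C` is the Kazhdan–Lusztig basis: a `ℂ(v)`-basis of the Hecke algebra consisting of
bar-invariant elements with `C_w = H_w + ∑_{w' ≺ w} P_{w',w}(v) H_{w'}` and
`P_{w',w} ∈ v ℤ[v]`. -/
structure IsKLBasis (n : ℕ) (C : Equiv.Perm (Fin n) → Hecke n) : Prop where
  linearIndependent : LinearIndependent K C
  span_eq_top : Submodule.span K (Set.range C) = ⊤
  bar_invariant : ∀ w, bar n (C w) = C w
  unitriangular : ∀ w, ∃ P : Equiv.Perm (Fin n) → Polynomial ℤ,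
    (∀ w', BruhatLT w' w → Polynomial.X ∣ P w') ∧
    C w = stdBasis w + ∑ w' with BruhatLT w' w, Polynomial.aeval v (P w') • stdBasis w'

/-- The Kazhdan–Lusztig basis element `C_w`, where `C` is the unique family satisfying
`IsKLBasis`. -/
noncomputable def klBasis {n : ℕ} (w : Equiv.Perm (Fin n)) : Hecke n :=
  Classical.epsilon (IsKLBasis n) w

/-! ### Combinatorics of the shortest coset representatives -/

/-- `W_k`, generated by `s_1, …, s_{k-1}`; this is the subgroup `S_k` of `S_n`. -/
def parabolic (n k : ℕ) : Subgroup (Equiv.Perm (Fin n)) :=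
  Subgroup.closure {s | ∃ i : SimpleIdx n, i.1 < k ∧ s = simple i}

/-- `W_k^⊥`, generated by `s_{k+1}, …, s_{n-1}`. -/
def parabolicPerp (n k : ℕ) : Subgroup (Equiv.Perm (Fin n)) :=
  Subgroup.closure {s | ∃ i : SimpleIdx n, k < i.1 ∧ s = simple i}

/-- The elements of `W_k` as a finite set. -/
noncomputable def parabolicFinset (n k : ℕ) : Finset (Equiv.Perm (Fin n)) :=
  (Set.toFinite (parabolic n k : Set (Equiv.Perm (Fin n)))).toFinset

/-- `w` is the longest element of `W_k`. -/
def IsLongest {n : ℕ} (k : ℕ) (w : Equiv.Perm (Fin n)) : Prop :=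
  w ∈ parabolic n k ∧ ∀ u ∈ parabolic n k, len u ≤ len w

/-- The set `D` of shortest representatives of the cosets `(W_k × W_k^⊥) z` in `S_n`. -/
def shortestReps (n k : ℕ) : Set (Equiv.Perm (Fin n)) :=
  {z | ∀ u ∈ parabolic n k ⊔ parabolicPerp n k, len z ≤ len (u * z)}

/-- The positions of the `∨`'s in the `∧∨`-sequence of `z`. This sequence is obtained from
`∧⋯∧∨⋯∨` (`k` times `∧`, then `n - k` times `∨`) by the right action of `z` on positions, in
which a product acts by its left factor first; as permutations are composed as functions here,
`z` moves the symbol at `q` to `z⁻¹ q`, and the symbol that arrives at `p` comes from `z p`. -/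
def veeSet {n : ℕ} (k : ℕ) (z : Equiv.Perm (Fin n)) : Finset (Fin n) :=
  Finset.univ.filter fun p => k ≤ (z p).1

theorem card_veeSet {n : ℕ} (k : ℕ) (z : Equiv.Perm (Fin n)) : (veeSet k z).card = n - k := by
  have h : (veeSet k z).map z.toEmbedding = Finset.univ.filter fun p : Fin n => k ≤ p.1 := by
    ext p
    simp only [veeSet, Finset.mem_map, Finset.mem_filter, Finset.mem_univ, true_and,
      Equiv.coe_toEmbedding]
    exact ⟨by rintro ⟨a, ha, rfl⟩; exact ha, fun hp => ⟨z.symm p, by simpa using hp, by simp⟩⟩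
  rw [← Finset.card_map z.toEmbedding, h, ← Finset.card_map Fin.valEmbedding]
  have h2 : (Finset.univ.filter fun p : Fin n => k ≤ p.1).map Fin.valEmbedding
      = Finset.Ico k n := by
    ext a
    simp only [Finset.mem_map, Finset.mem_filter, Finset.mem_univ, true_and,
      Fin.valEmbedding_apply, Finset.mem_Ico]
    exact ⟨by rintro ⟨p, hp, rfl⟩; exact ⟨hp, p.2⟩, fun ha => ⟨⟨a, ha.2⟩, ha.1, rfl⟩⟩
  rw [h2, Nat.card_Ico]

/-- The position, in `{1, …, n}`, of the `(m+1)`-st `∨` in `z`, counted from the left. -/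
def veePos {n : ℕ} (k : ℕ) (z : Equiv.Perm (Fin n)) (m : Fin (n - k)) : ℕ :=
  ((veeSet k z).orderEmbOfFin (card_veeSet k z) m).1 + 1

/-- The entry `z^∨_i` of the `∨`-distance sequence for `i = k + m + 1`, that is, `i` minus the
position of the `(i-k)`-th `∨` of `z`. That `∨` has at most `k` `∧`'s and exactly `m` `∨`'s on
its left, so the difference is never negative for `k ≤ n`. -/
def veeDist {n : ℕ} (k : ℕ) (z : Equiv.Perm (Fin n)) (m : Fin (n - k)) : ℕ :=
  (k + m.1 + 1) - veePos k z m

/-- `s_i` for a natural number `i` (the identity unless `1 ≤ i ≤ n - 1`). -/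
def simpleNat (n i : ℕ) : Equiv.Perm (Fin n) :=
  if h : 1 ≤ i ∧ i < n then simple ⟨i, h⟩ else 1

/-- `t^∨_{j,l} = s_{j-1} s_{j-2} ⋯ s_{j-l}`, with `t^∨_{j,0}` the identity. -/
def tVee (n j l : ℕ) : Equiv.Perm (Fin n) :=
  ((List.range l).map fun q => simpleNat n (j - 1 - q)).prod

/-- `t^∨_{k+1,i_{k+1}} ⋯ t^∨_{n,i_n}`, where `f m` stands for `i_{k+m+1}`. -/
def tVeeProd {n : ℕ} (k : ℕ) (f : Fin (n - k) → ℕ) : Equiv.Perm (Fin n) :=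
  (List.ofFn fun m : Fin (n - k) => tVee n (k + m.1 + 1) (f m)).prod

end SymHecke

namespace SymHecke

/-! The element C_w is the only bar-invariant element of H_w + ∑_y v ℤ[v] H_y
(`klBasis_eq_of_bar_eq`), so it suffices to check these two properties for the right-hand side with
w = w_k z.

The coefficients are the easy half: ℓ(w') ≤ ℓ(w_k) and i_j ≤ z^∨_j, so every exponent of v is
positive except for the single term w' = w_k, i = z^∨, which is H_{w_k z}.

Bar-invariance comes from a factorization. Lengths add in w' t^∨_{k+1,i_{k+1}} ⋯ t^∨_{n,i_n}
(`FixesFrom.mul_tVeeProd`), hence the sum equals `parabolicSum n k` times the product of the factors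
S_{J,l} = ∑_{q ≤ l} v^{l-q} H_J ⋯ H_{J-q+1} (`descSum`), with J = k, …, n-1 and l the corresponding
∨-distance. If X is bar-invariant and X H_i = v⁻¹ X for J-l < i < J, then X S_{J,l} is bar-invariant
(`bar_mul_descSum`) and is a v⁻¹-eigenvector of H_i for J-l < i ≤ J (`mul_descSum_mul_genNat`). The
∨-distances decrease weakly, so the eigenvector range left by one factor covers what the next one
needs (`mul_prod_descSum`). The starting element `parabolicSum n k` is built by the same step, with
l = J at each J < k.

The factorization of z itself follows by comparing z with y = `tVeeProd k (veeDist k z)`: both send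
the ∨-positions to the same places, so z y⁻¹ lies in W_k, and minimality of z together with
additivity of length forces z = y.

The background is developed from the presentation. The regular representation and a spanning set of
at most n! elements show that H_w is independent of the reduced word and that these elements form a
basis. A Kazhdan–Lusztig basis is then constructed, since `klBasis` is chosen by `epsilon` and has
no properties until one is known to exist. -/

/-! ### Length and inversions -/

/-- The element `i - 1` of `Fin n`, the left position moved by `simple i`. -/
def SimpleIdx.lo {n : ℕ} (i : SimpleIdx n) : Fin n :=
  ⟨i.1 - 1, lt_of_le_of_lt (Nat.sub_le _ _) i.2.2⟩

/-- The element `i` of `Fin n`, the right position moved by `simple i`. -/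
def SimpleIdx.hi {n : ℕ} (i : SimpleIdx n) : Fin n := ⟨i.1, i.2.2⟩

theorem SimpleIdx.lo_lt_hi {n : ℕ} (i : SimpleIdx n) : i.lo < i.hi := by
  have := i.2.1
  simp only [SimpleIdx.lo, SimpleIdx.hi, Fin.lt_def]
  omega

theorem simple_eq_swap {n : ℕ} (i : SimpleIdx n) : simple i = Equiv.swap i.lo i.hi := rfl

@[simp] theorem simple_mul_self {n : ℕ} (i : SimpleIdx n) : simple i * simple i = 1 := by
  rw [simple_eq_swap, Equiv.swap_mul_self]

@[simp] theorem simple_inv {n : ℕ} (i : SimpleIdx n) : (simple i)⁻¹ = simple i := by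
  rw [simple_eq_swap, Equiv.swap_inv]

@[simp] theorem simple_simple {n : ℕ} (i : SimpleIdx n) (x : Fin n) :
    simple i (simple i x) = x := by
  rw [← Equiv.Perm.mul_apply, simple_mul_self, Equiv.Perm.one_apply]

@[simp] theorem simple_lo {n : ℕ} (i : SimpleIdx n) : simple i i.lo = i.hi :=
  Equiv.swap_apply_left _ _

@[simp] theorem simple_hi {n : ℕ} (i : SimpleIdx n) : simple i i.hi = i.lo :=
  Equiv.swap_apply_right _ _

theorem simple_of_ne {n : ℕ} (i : SimpleIdx n) {x : Fin n} (h1 : x ≠ i.lo) (h2 : x ≠ i.hi) :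
    simple i x = x :=
  Equiv.swap_apply_of_ne_of_ne h1 h2

theorem mul_simple_mul_simple {n : ℕ} (w : Equiv.Perm (Fin n)) (i : SimpleIdx n) :
    w * simple i * simple i = w := by
  rw [mul_assoc, simple_mul_self, mul_one]

theorem simple_apply_lt {n : ℕ} (i : SimpleIdx n) {x y : Fin n} (h : x < y)
    (hne : ¬(x = i.lo ∧ y = i.hi)) : simple i x < simple i y := by
  have hi := i.2.1
  have hl : i.lo.1 = i.1 - 1 := rfl
  have hh : i.hi.1 = i.1 := rfl
  simp only [simple_eq_swap, Equiv.swap_apply_def, Fin.ext_iff, Fin.lt_def] at *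
  split_ifs <;> omega

/-- The set of inversions of a permutation. -/
def inversions {n : ℕ} (w : Equiv.Perm (Fin n)) : Finset (Fin n × Fin n) :=
  Finset.univ.filter fun p => p.1 < p.2 ∧ w p.2 < w p.1

theorem mem_inversions {n : ℕ} {w : Equiv.Perm (Fin n)} {p : Fin n × Fin n} :
    p ∈ inversions w ↔ p.1 < p.2 ∧ w p.2 < w p.1 := by
  simp [inversions]

/-- Applying s_i to both coordinates carries the inversions of w to inversions of w s_i. The only
pair whose order s_i reverses is (lo, hi), which is the one new inversion. -/
theorem inversions_mul_simple {n : ℕ} {w : Equiv.Perm (Fin n)} {i : SimpleIdx n}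
    (h : w i.lo < w i.hi) :
    (inversions (w * simple i)).card = (inversions w).card + 1 := by
  have hmem : (i.lo, i.hi) ∉ (inversions w).map
      ((simple i).prodCongr (simple i)).toEmbedding := by
    simp only [Finset.mem_map, mem_inversions, not_exists, not_and, Prod.forall]
    rintro a b ⟨hab, -⟩ heq
    simp only [Equiv.coe_toEmbedding, Equiv.prodCongr_apply, Prod.map_apply, Prod.mk.injEq] at heq
    have ha : a = i.hi := by rw [← simple_lo, ← heq.1, simple_simple]
    have hb : b = i.lo := by rw [← simple_hi, ← heq.2, simple_simple]
    subst ha hb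
    exact absurd hab i.lo_lt_hi.not_gt
  rw [← Finset.card_map (s := inversions w) ((simple i).prodCongr (simple i)).toEmbedding,
    ← Finset.card_insert_of_notMem hmem]
  congr 1
  ext ⟨a, b⟩
  simp only [Finset.mem_insert, Finset.mem_map, mem_inversions, Prod.exists,
    Equiv.coe_toEmbedding, Equiv.prodCongr_apply, Prod.map_apply, Prod.mk.injEq,
    Equiv.Perm.mul_apply]
  constructor
  · rintro ⟨hab, hw⟩
    by_cases hne : a = i.lo ∧ b = i.hi
    · exact Or.inl hne
    · exact Or.inr ⟨simple i a, simple i b, ⟨simple_apply_lt i hab hne, hw⟩, by simp⟩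
  · rintro (⟨rfl, rfl⟩ | ⟨x, y, ⟨hxy, hw⟩, rfl, rfl⟩)
    · exact ⟨i.lo_lt_hi, by simpa using h⟩
    · refine ⟨simple_apply_lt i hxy ?_, by simpa using hw⟩
      rintro ⟨rfl, rfl⟩
      exact absurd hw h.not_gt

theorem inversions_one {n : ℕ} : inversions (1 : Equiv.Perm (Fin n)) = ∅ := by
  ext p
  simp only [mem_inversions, Equiv.Perm.one_apply, Finset.notMem_empty, iff_false, not_and]
  exact fun h => h.not_gt

theorem ne_of_simple {n : ℕ} (w : Equiv.Perm (Fin n)) (i : SimpleIdx n) : w i.lo ≠ w i.hi :=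
  fun h => i.lo_lt_hi.ne (w.injective h)

theorem inversions_mul_simple_of_gt {n : ℕ} {w : Equiv.Perm (Fin n)} {i : SimpleIdx n}
    (h : w i.hi < w i.lo) :
    (inversions (w * simple i)).card + 1 = (inversions w).card := by
  rw [← inversions_mul_simple (w := w * simple i) (i := i) (by simpa using h),
    mul_simple_mul_simple]

theorem eq_one_of_no_descent {n : ℕ} {w : Equiv.Perm (Fin n)}
    (h : ∀ i : SimpleIdx n, w i.lo < w i.hi) : w = 1 := by
  have hmono : StrictMono w := by
    cases n with
    | zero => exact fun a => a.elim0
    | succ m =>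
      rw [Fin.strictMono_iff_lt_succ]
      intro i
      exact h ⟨i.1 + 1, by omega, by omega⟩
  have := Subsingleton.elim (hmono.orderIsoOfSurjective w w.surjective) (OrderIso.refl _)
  ext x
  exact congrArg Fin.val (congrArg (fun e : Fin n ≃o Fin n => e x) this)

theorem wordProd_cons {n : ℕ} (i : SimpleIdx n) (l : List (SimpleIdx n)) :
    wordProd (i :: l) = simple i * wordProd l := by
  simp [wordProd]

theorem wordProd_concat {n : ℕ} (i : SimpleIdx n) (l : List (SimpleIdx n)) :
    wordProd (l ++ [i]) = wordProd l * simple i := by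
  simp [wordProd]

theorem wordProd_reverse {n : ℕ} (l : List (SimpleIdx n)) :
    wordProd l.reverse = (wordProd l)⁻¹ := by
  induction l with
  | nil => simp [wordProd]
  | cons i l ih => rw [List.reverse_cons, wordProd_concat, ih, wordProd_cons, mul_inv_rev,
      simple_inv]

theorem card_inversions_wordProd_le {n : ℕ} (l : List (SimpleIdx n)) :
    (inversions (wordProd l)).card ≤ l.length := by
  induction l using List.reverseRecOn with
  | nil => simp [wordProd, inversions_one]
  | append_singleton l i ih =>
    rw [wordProd_concat, List.length_append, List.length_singleton]
    rcases lt_or_gt_of_ne (ne_of_simple (wordProd l) i) with h | h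
    · rw [inversions_mul_simple h]; omega
    · have := inversions_mul_simple_of_gt h; omega

theorem exists_word_card_inversions {n : ℕ} (w : Equiv.Perm (Fin n)) :
    ∃ l : List (SimpleIdx n), l.length = (inversions w).card ∧ wordProd l = w := by
  induction hm : (inversions w).card generalizing w with
  | zero =>
    refine ⟨[], rfl, (eq_one_of_no_descent fun i => ?_).symm⟩
    refine (lt_or_gt_of_ne (ne_of_simple w i)).resolve_right fun h => ?_
    have := inversions_mul_simple_of_gt h
    omega
  | succ m ih =>
    have hex : ∃ i : SimpleIdx n, w i.hi < w i.lo := by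
      by_contra! hcon
      have h1 : w = 1 := eq_one_of_no_descent fun i =>
        lt_of_le_of_ne (hcon i) (ne_of_simple w i)
      rw [h1, inversions_one] at hm
      simp at hm
    obtain ⟨i, hi⟩ := hex
    have h2 := inversions_mul_simple_of_gt hi
    obtain ⟨l, hl, hw⟩ := ih (w * simple i) (by omega)
    exact ⟨l ++ [i], by simp [hl], by rw [wordProd_concat, hw, mul_simple_mul_simple]⟩

theorem len_le_length {n : ℕ} (l : List (SimpleIdx n)) : len (wordProd l) ≤ l.length :=
  Nat.sInf_le ⟨l, rfl, rfl⟩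

theorem len_eq_card_inversions {n : ℕ} (w : Equiv.Perm (Fin n)) :
    len w = (inversions w).card := by
  apply le_antisymm
  · obtain ⟨l, hl, hw⟩ := exists_word_card_inversions w
    rw [← hl, ← hw]
    exact len_le_length l
  · obtain ⟨l, hl, hlen⟩ := exists_reducedWord w
    rw [← hlen, ← hl]
    exact card_inversions_wordProd_le l

theorem len_mul_simple {n : ℕ} {w : Equiv.Perm (Fin n)} {i : SimpleIdx n}
    (h : w i.lo < w i.hi) : len (w * simple i) = len w + 1 := by
  rw [len_eq_card_inversions, len_eq_card_inversions, inversions_mul_simple h]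

theorem len_mul_simple_of_gt {n : ℕ} {w : Equiv.Perm (Fin n)} {i : SimpleIdx n}
    (h : w i.hi < w i.lo) : len (w * simple i) + 1 = len w := by
  rw [len_eq_card_inversions, len_eq_card_inversions, inversions_mul_simple_of_gt h]

theorem len_one {n : ℕ} : len (1 : Equiv.Perm (Fin n)) = 0 := by
  rw [len_eq_card_inversions, inversions_one, Finset.card_empty]

theorem eq_one_of_len_eq_zero {n : ℕ} {w : Equiv.Perm (Fin n)} (h : len w = 0) : w = 1 := by
  obtain ⟨l, hl, hlen⟩ := exists_reducedWord w
  rw [h, List.length_eq_zero_iff] at hlen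
  rw [← hl, hlen]
  rfl

theorem len_inv_le {n : ℕ} (w : Equiv.Perm (Fin n)) : len w⁻¹ ≤ len w := by
  obtain ⟨l, hl, hlen⟩ := exists_reducedWord w
  rw [← hlen, ← hl, ← wordProd_reverse, ← List.length_reverse]
  exact len_le_length _

theorem len_inv {n : ℕ} (w : Equiv.Perm (Fin n)) : len w⁻¹ = len w :=
  le_antisymm (len_inv_le w) (by simpa using len_inv_le w⁻¹)

theorem len_simple_mul_of_gt {n : ℕ} {w : Equiv.Perm (Fin n)} {i : SimpleIdx n}
    (h : w⁻¹ i.hi < w⁻¹ i.lo) : len (simple i * w) + 1 = len w := by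
  rw [← len_inv (simple i * w), mul_inv_rev, simple_inv, len_mul_simple_of_gt h, len_inv]

theorem exists_descent {n : ℕ} {w : Equiv.Perm (Fin n)} (h : len w ≠ 0) :
    ∃ i : SimpleIdx n, w i.hi < w i.lo := by
  by_contra! hcon
  exact h (by rw [eq_one_of_no_descent fun i => lt_of_le_of_ne (hcon i) (ne_of_simple w i),
    len_one])

/-! ### The Bruhat order -/

/-- An inversion (x, y) of u is sent to (t x, t y) if this pair is still increasing and is kept
otherwise. In the latter case x = a or y = b, and u a < u b keeps (x, y) an inversion of u t. This
injection misses the inversion (a, b) of u t. -/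
theorem len_lt_len_mul_swap {n : ℕ} {u : Equiv.Perm (Fin n)} {a b : Fin n} (hab : a < b)
    (h : u a < u b) : len u < len (u * Equiv.swap a b) := by
  rw [len_eq_card_inversions, len_eq_card_inversions]
  have htt : ∀ x, Equiv.swap a b (Equiv.swap a b x) = x := Equiv.swap_apply_self a b
  set t := Equiv.swap a b with ht
  have hta : t a = b := Equiv.swap_apply_left a b
  have htb : t b = a := Equiv.swap_apply_right a b
  have hmem : (a, b) ∈ inversions (u * t) := by
    rw [mem_inversions]
    simpa [hta, htb] using ⟨hab, h⟩
  rw [← Finset.card_erase_add_one hmem, Nat.lt_succ_iff]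
  refine Finset.card_le_card_of_injOn
    (fun p => if t p.1 < t p.2 then (t p.1, t p.2) else p) ?_ ?_
  · rintro ⟨x, y⟩ hxy
    rw [Finset.mem_coe, mem_inversions] at hxy
    obtain ⟨hlt, hu⟩ := hxy
    dsimp only at hlt hu ⊢
    rw [Finset.mem_coe, Finset.mem_erase, mem_inversions]
    split_ifs with hc
    · refine ⟨?_, hc, by simpa [htt] using hu⟩
      rw [ne_eq, Prod.mk.injEq]
      rintro ⟨h1, h2⟩
      have hx : x = b := by rw [← htt x, h1, hta]
      have hy : y = a := by rw [← htt y, h2, htb]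
      subst hx hy
      exact absurd hlt hab.not_gt
    · have hne : (x, y) ≠ (a, b) := by
        rw [ne_eq, Prod.mk.injEq]
        rintro ⟨rfl, rfl⟩
        exact absurd hu h.not_gt
      refine ⟨hne, hlt, ?_⟩
      simp only [Equiv.Perm.mul_apply]
      by_cases hxa : x = a
      · subst hxa
        have hyb : y ≠ b := fun hyb => hne (by rw [hyb])
        have hy : t y = y := Equiv.swap_apply_of_ne_of_ne hlt.ne' hyb
        rw [hta, hy]
        exact hu.trans h
      · by_cases hyb : y = b
        · subst hyb
          have hx : t x = x := Equiv.swap_apply_of_ne_of_ne hxa hlt.ne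
          rw [htb, hx]
          exact h.trans hu
        · exfalso
          apply hc
          simp only [ht, Equiv.swap_apply_def]
          rw [if_neg hxa, if_neg hyb]
          split_ifs with h1 h2 h2
          · subst h1 h2; exact absurd hab hlt.not_gt
          · subst h1; exact hab.trans hlt
          · subst h2; exact hlt.trans hab
          · exact hlt
  · rintro ⟨x, y⟩ hxy ⟨x', y'⟩ hxy' heq
    rw [Finset.mem_coe, mem_inversions] at hxy hxy'
    have h1 := hxy.1
    have h2 := hxy'.1
    dsimp only at heq h1 h2
    split_ifs at heq with hc hc' hc'
    · rw [Prod.mk.injEq] at heq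
      rw [t.injective heq.1, t.injective heq.2]
    · rw [Prod.mk.injEq] at heq
      rw [← heq.1, ← heq.2, htt, htt] at hc'
      exact absurd h1 hc'
    · rw [Prod.mk.injEq] at heq
      rw [heq.1, heq.2, htt, htt] at hc
      exact absurd h2 hc
    · exact heq

/-- The covering-type relation `u → u t` generating the Bruhat order. -/
def BruhatStep {n : ℕ} (u w : Equiv.Perm (Fin n)) : Prop :=
  ∃ t : Equiv.Perm (Fin n), t.IsSwap ∧ w = u * t ∧ len u < len w

theorem bruhatLT_iff {n : ℕ} {u w : Equiv.Perm (Fin n)} :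
    BruhatLT u w ↔ Relation.TransGen BruhatStep u w := Iff.rfl

theorem BruhatLT.len_lt {n : ℕ} {u w : Equiv.Perm (Fin n)} (h : BruhatLT u w) :
    len u < len w := by
  rw [bruhatLT_iff] at h
  induction h with
  | single h => obtain ⟨t, -, -, h⟩ := h; exact h
  | tail _ h ih => obtain ⟨t, -, -, h⟩ := h; exact ih.trans h

theorem BruhatLT.trans {n : ℕ} {u w x : Equiv.Perm (Fin n)} (h : BruhatLT u w)
    (h' : BruhatLT w x) : BruhatLT u x :=
  Relation.TransGen.trans h h'

theorem bruhatStep_simple {n : ℕ} {w : Equiv.Perm (Fin n)} {i : SimpleIdx n}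
    (h : w i.lo < w i.hi) : BruhatStep w (w * simple i) :=
  ⟨simple i, ⟨i.lo, i.hi, i.lo_lt_hi.ne, rfl⟩, rfl, by rw [len_mul_simple h]; omega⟩

/-- Conjugating t = (a b) by s = s_i gives w s = (u s)(s t s). The step still raises the length
because s preserves the order of a < b, unless t = s, which is the first alternative. -/
theorem BruhatStep.mul_simple {n : ℕ} {u w : Equiv.Perm (Fin n)} (h : BruhatStep u w)
    (i : SimpleIdx n) : w = u * simple i ∨ BruhatStep (u * simple i) (w * simple i) := by
  obtain ⟨t, ⟨a, b, hab, rfl⟩, rfl, hlt⟩ := h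
  wlog hlt' : a < b generalizing a b
  · rw [Equiv.swap_comm] at hlt ⊢
    exact this b a hab.symm hlt (lt_of_le_of_ne (not_lt.1 hlt') hab.symm)
  have hu : u a < u b := by
    by_contra hcon
    have hba : u b < u a := lt_of_le_of_ne (not_lt.1 hcon) fun h => hab (u.injective h).symm
    have := len_lt_len_mul_swap (u := u * Equiv.swap a b) hlt' (by simpa using hba)
    rw [mul_assoc, Equiv.swap_mul_self, mul_one] at this
    omega
  by_cases hne : a = i.lo ∧ b = i.hi
  · left; rw [hne.1, hne.2]; rfl
  · right
    have hconj : u * Equiv.swap a b * simple i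
        = u * simple i * Equiv.swap (simple i a) (simple i b) := by
      rw [Equiv.swap_apply_apply, simple_inv]
      simp only [← mul_assoc]
      rw [mul_simple_mul_simple]
    refine ⟨Equiv.swap (simple i a) (simple i b), ⟨_, _, ?_, rfl⟩, hconj, ?_⟩
    · exact fun h => hab ((simple i).injective h)
    · rw [hconj]
      exact len_lt_len_mul_swap (simple_apply_lt i hlt' hne) (by simpa using hu)

/-- The lifting property of the Bruhat order. -/
theorem bruhat_lifting {n : ℕ} {u w : Equiv.Perm (Fin n)} {i : SimpleIdx n}
    (h : Relation.ReflTransGen BruhatStep u w) (hw : w i.lo < w i.hi) :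
    Relation.ReflTransGen BruhatStep (u * simple i) (w * simple i) := by
  induction h using Relation.ReflTransGen.head_induction_on with
  | refl => exact Relation.ReflTransGen.refl
  | head hstep hrest ih =>
    rcases hstep.mul_simple i with h | h
    · rw [← h]
      exact hrest.tail (bruhatStep_simple hw)
    · exact ih.head h

/-! ### The regular representation -/

/-- The operator on the group algebra by which `H_i` acts from the left. -/
noncomputable def leftOp {n : ℕ} (i : SimpleIdx n) :
    (Equiv.Perm (Fin n) →₀ K) →ₗ[K] (Equiv.Perm (Fin n) →₀ K) :=
  Finsupp.linearCombination K fun w : Equiv.Perm (Fin n) =>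
    Finsupp.single (simple i * w) (1 : K) +
      if w⁻¹ i.lo < w⁻¹ i.hi then 0 else (v⁻¹ - v) • Finsupp.single w (1 : K)

theorem leftOp_of_lt {n : ℕ} {i : SimpleIdx n} {w : Equiv.Perm (Fin n)}
    (h : w⁻¹ i.lo < w⁻¹ i.hi) :
    leftOp i (Finsupp.single w 1) = Finsupp.single (simple i * w) 1 := by
  rw [leftOp, Finsupp.linearCombination_single, one_smul, if_pos h, add_zero]

theorem leftOp_of_gt {n : ℕ} {i : SimpleIdx n} {w : Equiv.Perm (Fin n)}
    (h : w⁻¹ i.hi < w⁻¹ i.lo) :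
    leftOp i (Finsupp.single w 1) =
      Finsupp.single (simple i * w) 1 + (v⁻¹ - v) • Finsupp.single w 1 := by
  rw [leftOp, Finsupp.linearCombination_single, one_smul, if_neg h.not_gt]

theorem simple_simple_mul {n : ℕ} (i : SimpleIdx n) (w : Equiv.Perm (Fin n)) :
    simple i * (simple i * w) = w := by
  rw [← mul_assoc, simple_mul_self, one_mul]

theorem inv_simple_mul_apply {n : ℕ} (i : SimpleIdx n) (w : Equiv.Perm (Fin n)) (x : Fin n) :
    (simple i * w)⁻¹ x = w⁻¹ (simple i x) := by
  rw [mul_inv_rev, simple_inv, Equiv.Perm.mul_apply]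

theorem linearMap_ext_single {n : ℕ}
    {f g : (Equiv.Perm (Fin n) →₀ K) →ₗ[K] (Equiv.Perm (Fin n) →₀ K)}
    (h : ∀ w, f (Finsupp.single w 1) = g (Finsupp.single w 1)) : f = g :=
  Finsupp.lhom_ext' fun w => LinearMap.ext_ring (h w)

theorem leftOp_quad {n : ℕ} (i : SimpleIdx n) :
    leftOp i * leftOp i = (v⁻¹ - v) • leftOp i + 1 := by
  refine linearMap_ext_single fun w => ?_
  simp only [Module.End.mul_apply, LinearMap.add_apply, LinearMap.smul_apply,
    Module.End.one_apply]
  rcases lt_or_gt_of_ne (ne_of_simple w⁻¹ i) with h | h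
  · rw [leftOp_of_lt h, leftOp_of_gt (by simpa [inv_simple_mul_apply] using h),
      simple_simple_mul, add_comm]
  · rw [leftOp_of_gt h, map_add, map_smul, leftOp_of_gt h,
      leftOp_of_lt (by simpa [inv_simple_mul_apply] using h), simple_simple_mul, add_comm]

theorem simple_comm {n : ℕ} {i j : SimpleIdx n} (h : 1 < |(i.1 : ℤ) - (j.1 : ℤ)|) :
    simple i * simple j = simple j * simple i := by
  have hi := i.2.1
  have hj := j.2.1
  refine (Equiv.Perm.Disjoint.commute ?_).eq
  rw [lt_abs] at h
  simp only [simple_eq_swap]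
  intro x
  have e1 : i.lo.1 = i.1 - 1 := rfl
  have e2 : i.hi.1 = i.1 := rfl
  have e3 : j.lo.1 = j.1 - 1 := rfl
  have e4 : j.hi.1 = j.1 := rfl
  simp only [Equiv.swap_apply_def, Fin.ext_iff]
  split_ifs <;> omega

theorem simple_apply_of_far {n : ℕ} {i j : SimpleIdx n} (h : 1 < |(i.1 : ℤ) - (j.1 : ℤ)|) :
    simple i j.lo = j.lo ∧ simple i j.hi = j.hi := by
  have hi := i.2.1
  have hj := j.2.1
  rw [lt_abs] at h
  have e1 : i.lo.1 = i.1 - 1 := rfl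
  have e2 : i.hi.1 = i.1 := rfl
  have e3 : j.lo.1 = j.1 - 1 := rfl
  have e4 : j.hi.1 = j.1 := rfl
  constructor <;> apply simple_of_ne <;> rw [ne_eq, Fin.ext_iff] <;> omega

theorem leftOp_comm {n : ℕ} {i j : SimpleIdx n} (h : 1 < |(i.1 : ℤ) - (j.1 : ℤ)|) :
    leftOp i * leftOp j = leftOp j * leftOp i := by
  refine linearMap_ext_single fun w => ?_
  simp only [Module.End.mul_apply]
  obtain ⟨a1, a2⟩ := simple_apply_of_far h
  obtain ⟨b1, b2⟩ := simple_apply_of_far (abs_sub_comm (i.1 : ℤ) j.1 ▸ h)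
  have hc : simple i * (simple j * w) = simple j * (simple i * w) := by
    rw [← mul_assoc, simple_comm h, mul_assoc]
  rcases lt_or_gt_of_ne (ne_of_simple w⁻¹ i) with hi | hi <;>
  rcases lt_or_gt_of_ne (ne_of_simple w⁻¹ j) with hj | hj
  · rw [leftOp_of_lt hi, leftOp_of_lt hj, leftOp_of_lt (by simpa [inv_simple_mul_apply, b1, b2]),
      leftOp_of_lt (by simpa [inv_simple_mul_apply, a1, a2]), hc]
  · rw [leftOp_of_lt hi, leftOp_of_gt hj, map_add, map_smul,
      leftOp_of_lt (by simpa [inv_simple_mul_apply, b1, b2]), leftOp_of_lt hi,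
      leftOp_of_gt (by simpa [inv_simple_mul_apply, a1, a2]), hc]
  · rw [leftOp_of_gt hi, leftOp_of_lt hj, map_add, map_smul,
      leftOp_of_gt (by simpa [inv_simple_mul_apply, b1, b2]), leftOp_of_lt hj,
      leftOp_of_lt (by simpa [inv_simple_mul_apply, a1, a2]), hc]
  · rw [leftOp_of_gt hi, leftOp_of_gt hj, map_add, map_smul, map_add, map_smul,
      leftOp_of_gt (by simpa [inv_simple_mul_apply, b1, b2]), leftOp_of_gt hi, leftOp_of_gt hj,
      leftOp_of_gt (by simpa [inv_simple_mul_apply, a1, a2]), hc]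
    simp only [smul_add]
    abel

theorem simple_braid {n : ℕ} {i j : SimpleIdx n} (h : j.1 = i.1 + 1) :
    simple i * simple j * simple i = simple j * simple i * simple j := by
  have hi := i.2.1
  have e1 : i.lo.1 = i.1 - 1 := rfl
  have e2 : i.hi.1 = i.1 := rfl
  have e3 : j.lo.1 = j.1 - 1 := rfl
  have e4 : j.hi.1 = j.1 := rfl
  have hm : j.lo = i.hi := by rw [Fin.ext_iff]; omega
  have h1 : i.lo ≠ j.hi := by rw [ne_eq, Fin.ext_iff]; omega
  have h2 : i.lo ≠ i.hi := i.lo_lt_hi.ne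
  have h3 : i.hi ≠ j.hi := hm ▸ j.lo_lt_hi.ne
  simp only [simple_eq_swap, hm]
  rw [Equiv.swap_mul_swap_mul_swap h2 h1, Equiv.swap_comm i.lo i.hi, Equiv.swap_comm i.hi j.hi,
    Equiv.swap_mul_swap_mul_swap h3.symm h1.symm, Equiv.swap_comm]

/-- Only the relative order of w⁻¹ at the three adjacent places i.lo, i.hi, j.hi matters. Of the
eight sign patterns two contradict transitivity; in the other six both sides are computed. -/
theorem leftOp_braid {n : ℕ} {i j : SimpleIdx n} (h : j.1 = i.1 + 1) :
    leftOp i * leftOp j * leftOp i = leftOp j * leftOp i * leftOp j := by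
  refine linearMap_ext_single fun w => ?_
  simp only [Module.End.mul_apply]
  have hi := i.2.1
  have e1 : i.lo.1 = i.1 - 1 := rfl
  have e2 : i.hi.1 = i.1 := rfl
  have e3 : j.lo.1 = j.1 - 1 := rfl
  have e4 : j.hi.1 = j.1 := rfl
  have hm : j.lo = i.hi := by rw [Fin.ext_iff]; omega
  have h1 : simple i j.hi = j.hi := by
    apply simple_of_ne <;> rw [ne_eq, Fin.ext_iff] <;> omega
  have h2 : simple j i.lo = i.lo := by
    apply simple_of_ne <;> rw [ne_eq, Fin.ext_iff] <;> omega
  have h3 : simple j i.hi = j.hi := by rw [← hm, simple_lo]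
  have h4 : simple j j.hi = i.hi := by rw [simple_hi, hm]
  have hb : simple j * (simple i * (simple j * w)) = simple i * (simple j * (simple i * w)) := by
    simp only [← mul_assoc]
    rw [simple_braid h]
  have hjj : w⁻¹ i.hi ≠ w⁻¹ j.hi := hm ▸ ne_of_simple w⁻¹ j
  have hij : w⁻¹ i.lo ≠ w⁻¹ j.hi := fun hc => by
    have := w⁻¹.injective hc
    rw [Fin.ext_iff] at this
    omega
  rcases lt_or_gt_of_ne (ne_of_simple w⁻¹ i) with ha | ha <;>
  rcases lt_or_gt_of_ne hjj with hb' | hb' <;>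
  rcases lt_or_gt_of_ne hij with hc | hc <;>
  first
  | exact absurd (ha.trans hb') hc.not_gt
  | exact absurd (hb'.trans ha) hc.not_gt
  | (simp only [leftOp, map_add, map_smul, Finsupp.linearCombination_single, one_smul,
      inv_simple_mul_apply, hm, h1, h2, h3, h4, simple_lo, simple_hi, ha, hb', hc, ha.not_gt,
      hb'.not_gt, hc.not_gt, if_true, if_false, add_zero, simple_simple_mul, hb]
     try (simp only [smul_add]; abel))

/-- The left regular representation, in the basis of the `T_w`. -/
noncomputable def regRep (n : ℕ) : Hecke n →ₐ[K] Module.End K (Equiv.Perm (Fin n) →₀ K) :=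
  RingQuot.liftAlgHom K ⟨FreeAlgebra.lift K leftOp, by
    intro x y h
    cases h with
    | comm i j h => simpa using leftOp_comm h
    | braid i j h => simpa using leftOp_braid h
    | quad i => simpa using leftOp_quad i⟩

theorem regRep_gen {n : ℕ} (i : SimpleIdx n) : regRep n (gen i) = leftOp i := by
  have : regRep n (toHecke n (FreeAlgebra.ι K i)) = FreeAlgebra.lift K leftOp (FreeAlgebra.ι K i) :=
    RingQuot.liftAlgHom_mkAlgHom_apply K _ _ _
  rw [gen, this, FreeAlgebra.lift_ι_apply]

/-- The orbit map of the regular representation. -/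
noncomputable def orbitMap (n : ℕ) : Hecke n →ₗ[K] (Equiv.Perm (Fin n) →₀ K) :=
  (LinearMap.applyₗ (Finsupp.single 1 1)).comp (regRep n).toLinearMap

theorem orbitMap_apply {n : ℕ} (x : Hecke n) :
    orbitMap n x = regRep n x (Finsupp.single 1 1) := rfl

/-- The product of generators along a word. -/
noncomputable def genProd {n : ℕ} (l : List (SimpleIdx n)) : Hecke n := (l.map gen).prod

/-- Each suffix of a reduced word is reduced, so only the length-increasing case of `leftOp` occurs
and no correction term appears. -/
theorem orbitMap_genProd {n : ℕ} {w : Equiv.Perm (Fin n)} {l : List (SimpleIdx n)}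
    (h : IsReducedWord l w) : orbitMap n (genProd l) = Finsupp.single w 1 := by
  obtain ⟨rfl, hl⟩ := h
  induction l with
  | nil => simp [genProd, orbitMap_apply, wordProd]
  | cons i l ih =>
    rw [wordProd_cons, List.length_cons] at hl
    have h0 := len_le_length l
    have hlt : (wordProd l)⁻¹ i.lo < (wordProd l)⁻¹ i.hi := by
      refine (lt_or_gt_of_ne (ne_of_simple (wordProd l)⁻¹ i)).resolve_right fun hgt => ?_
      have := len_simple_mul_of_gt hgt
      omega
    have h1 : len (simple i * wordProd l) = len (wordProd l) + 1 := by
      rw [← len_inv, mul_inv_rev, simple_inv, len_mul_simple hlt, len_inv]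
    have ih' := ih (by omega)
    rw [orbitMap_apply] at ih' ⊢
    rw [genProd, List.map_cons, List.prod_cons, map_mul, Module.End.mul_apply, regRep_gen,
      ← genProd, ih', leftOp_of_lt hlt, wordProd_cons]

/-! ### Descending products of generators -/

/-- `H_i` for a natural number `i` (`1` outside the range). -/
noncomputable def genNat (n i : ℕ) : Hecke n :=
  if h : 1 ≤ i ∧ i < n then gen ⟨i, h⟩ else 1

theorem genNat_eq {n i : ℕ} (h : 1 ≤ i ∧ i < n) : genNat n i = gen ⟨i, h⟩ := dif_pos h

theorem genNat_comm {n i j : ℕ} (h : i + 1 < j) :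
    genNat n i * genNat n j = genNat n j * genNat n i := by
  unfold genNat
  split_ifs with h1 h2 <;> try simp
  exact gen_comm _ _ (by rw [lt_abs]; dsimp only; omega)

theorem genNat_braid {n i : ℕ} (h0 : 1 ≤ i) (h : i + 1 < n) :
    genNat n (i + 1) * genNat n i * genNat n (i + 1) = genNat n i * genNat n (i + 1) * genNat n i := by
  rw [genNat_eq ⟨h0, by omega⟩, genNat_eq ⟨by omega, h⟩]
  exact (gen_braid _ _ rfl).symm

theorem genNat_quad {n i : ℕ} (h : 1 ≤ i ∧ i < n) :
    genNat n i * genNat n i = (v⁻¹ - v) • genNat n i + 1 := by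
  rw [genNat_eq h, gen_quad]

/-- The descending product `H_J H_{J-1} ⋯ H_{J-q+1}`. -/
noncomputable def descProd (n J q : ℕ) : Hecke n :=
  ((List.range q).map fun p => genNat n (J - p)).prod

@[simp] theorem descProd_zero (n J : ℕ) : descProd n J 0 = 1 := rfl

theorem descProd_succ (n J q : ℕ) :
    descProd n J (q + 1) = descProd n J q * genNat n (J - q) := by
  simp [descProd, List.range_succ]

theorem descProd_mul_genNat_far {n J q i : ℕ} (hJ : q + i < J) :
    descProd n J q * genNat n i = genNat n i * descProd n J q := by
  induction q with
  | zero => simp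
  | succ q ih =>
    rw [descProd_succ, mul_assoc, ← genNat_comm (by omega), ← mul_assoc, ih (by omega), mul_assoc]

theorem descProd_mul_genNat_self {n J r : ℕ} (hr : r < J) (hJ : J < n) :
    descProd n J (r + 1) * genNat n (J - r) =
      (v⁻¹ - v) • descProd n J (r + 1) + descProd n J r := by
  rw [descProd_succ, mul_assoc, genNat_quad ⟨by omega, by omega⟩, mul_add, mul_one, mul_smul_comm]

/-- Both H_{i+1} and H_i occur in the descending product. H_{i+1} commutes past the factors below
H_i, one braid relation turns it into H_i, and this commutes past the factors above H_{i+1}. -/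
theorem descProd_mul_genNat_mem {n J q i : ℕ} (hi : 1 ≤ i) (hiJ : i < J) (hq : J < q + i) (hqJ : q ≤ J)
    (hJ : J < n) :
    descProd n J q * genNat n (i + 1) = genNat n i * descProd n J q := by
  obtain ⟨r, rfl⟩ : ∃ r, J = i + 1 + r := ⟨J - (i + 1), by omega⟩
  obtain ⟨d, rfl⟩ : ∃ d, q = r + 2 + d := ⟨q - (r + 2), by omega⟩
  clear hq
  induction d with
  | zero =>
    rw [add_zero, descProd_succ, descProd_succ, show i + 1 + r - r = i + 1 by omega,
      show i + 1 + r - (r + 1) = i by omega]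
    calc _ = descProd n (i + 1 + r) r * (genNat n (i + 1) * genNat n i * genNat n (i + 1)) := by
          simp only [mul_assoc]
      _ = descProd n (i + 1 + r) r * genNat n i * (genNat n (i + 1) * genNat n i) := by
          rw [genNat_braid hi (by omega)]; simp only [mul_assoc]
      _ = _ := by rw [descProd_mul_genNat_far (by omega)]; simp only [mul_assoc]
  | succ d ih =>
    rw [← add_assoc, descProd_succ, mul_assoc, genNat_comm (i := _ - _) (j := i + 1) (by omega),
      ← mul_assoc, ih (by omega), mul_assoc]

/-! ### A spanning set of `n!` elements -/

open scoped Pointwise in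
open Classical in
/-- The products of descending products, one for each level below `j`. -/
noncomputable def normalForms (n : ℕ) : ℕ → Finset (Hecke n)
  | 0 => {1}
  | j + 1 => normalForms n j * (Finset.range (j + 1)).image (descProd n j)

open scoped Pointwise in
theorem card_normalForms_le (n j : ℕ) : (normalForms n j).card ≤ j.factorial := by
  classical
  induction j with
  | zero => simp [normalForms]
  | succ j ih =>
    rw [normalForms, Nat.factorial_succ, mul_comm]
    refine Finset.card_mul_le.trans (Nat.mul_le_mul (by convert ih) ?_)
    exact Finset.card_image_le.trans (Finset.card_range _).le

open scoped Pointwise in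
theorem mul_descProd_mem_span {n j q : ℕ} {x : Hecke n} (hq : q ≤ j)
    (hx : x ∈ Submodule.span K (normalForms n j : Set (Hecke n))) :
    x * descProd n j q ∈ Submodule.span K (normalForms n (j + 1) : Set (Hecke n)) := by
  classical
  rw [normalForms, Finset.coe_mul, ← Submodule.span_mul_span]
  refine Submodule.mul_mem_mul hx (Submodule.subset_span ?_)
  rw [Finset.mem_coe, Finset.mem_image]
  exact ⟨q, Finset.mem_range.2 (by omega), rfl⟩

open scoped Pointwise in
theorem span_normalForms_induction {n j : ℕ} {p : Hecke n → Prop}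
    (hmul : ∀ x ∈ Submodule.span K (normalForms n j : Set (Hecke n)), ∀ q ≤ j,
      p (x * descProd n j q))
    (hadd : ∀ x y, p x → p y → p (x + y)) {x : Hecke n}
    (hx : x ∈ Submodule.span K (normalForms n (j + 1) : Set (Hecke n))) : p x := by
  classical
  rw [normalForms, Finset.coe_mul, ← Submodule.span_mul_span] at hx
  refine Submodule.mul_induction_on hx (fun a ha b hb => ?_) hadd
  revert a
  refine Submodule.span_induction (fun b hb a ha => ?_) (fun a ha => ?_)
    (fun b c _ _ hb hc a ha => ?_) (fun r b _ hb a ha => ?_) hb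
  · rw [Finset.mem_coe, Finset.mem_image] at hb
    obtain ⟨q, hq, rfl⟩ := hb
    exact hmul a ha q (by rw [Finset.mem_range] at hq; omega)
  · simpa using hmul 0 (zero_mem _) 0 (Nat.zero_le _)
  · rw [mul_add]; exact hadd _ _ (hb a ha) (hc a ha)
  · rw [mul_smul_comm, ← smul_mul_assoc]
    exact hb _ (Submodule.smul_mem _ _ ha)

/-- For the last factor D_q = H_j ⋯ H_{j-q+1}, multiplication by H_i commutes past it, lengthens it,
shortens it by the quadratic relation, or passes through it as H_{i-1}, according as q + i is less
than j, equal to j, equal to j + 1, or larger. The first and last cases reduce to the previous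
level. -/
theorem mul_genNat_mem_span {n j i : ℕ} (hj : j ≤ n) (hi : 1 ≤ i) (hij : i < j) {x : Hecke n}
    (hx : x ∈ Submodule.span K (normalForms n j : Set (Hecke n))) :
    x * genNat n i ∈ Submodule.span K (normalForms n j : Set (Hecke n)) := by
  induction j generalizing i x with
  | zero => omega
  | succ j ih =>
    refine span_normalForms_induction (p := fun x => x * genNat n i ∈
      Submodule.span K (normalForms n (j + 1) : Set (Hecke n))) (fun x hx q hq => ?_)
      (fun x y hx hy => by rw [add_mul]; exact add_mem hx hy) hx
    rw [mul_assoc]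
    rcases lt_trichotomy (q + i) j with h | h | h
    · rw [descProd_mul_genNat_far h, ← mul_assoc]
      exact mul_descProd_mem_span hq (ih (by omega) hi (by omega) hx)
    · obtain rfl : i = j - q := by omega
      rw [← descProd_succ]
      exact mul_descProd_mem_span (by omega) hx
    · by_cases h1 : j + 1 = q + i
      · obtain ⟨r, rfl⟩ : ∃ r, q = r + 1 := ⟨q - 1, by omega⟩
        obtain rfl : i = j - r := by omega
        rw [descProd_mul_genNat_self (by omega) (by omega), mul_add, mul_smul_comm]
        exact add_mem (Submodule.smul_mem _ _ (mul_descProd_mem_span hq hx))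
          (mul_descProd_mem_span (by omega) hx)
      · obtain ⟨i, rfl⟩ : ∃ i', i = i' + 1 := ⟨i - 1, by omega⟩
        rw [descProd_mul_genNat_mem (by omega) (by omega) (by omega) hq (by omega), ← mul_assoc]
        exact mul_descProd_mem_span hq (ih (by omega) (by omega) (by omega) hx)

theorem one_mem_span_normalForms (n j : ℕ) :
    (1 : Hecke n) ∈ Submodule.span K (normalForms n j : Set (Hecke n)) := by
  induction j with
  | zero => exact Submodule.subset_span (by simp [normalForms])
  | succ j ih => simpa using mul_descProd_mem_span (Nat.zero_le j) ih

theorem hecke_induction {n : ℕ} {p : Hecke n → Prop} (halg : ∀ c : K, p (algebraMap K _ c))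
    (hgen : ∀ i, p (gen i)) (hmul : ∀ x y, p x → p y → p (x * y))
    (hadd : ∀ x y, p x → p y → p (x + y)) (x : Hecke n) : p x := by
  obtain ⟨y, rfl⟩ : ∃ y, toHecke n y = x := RingQuot.mkAlgHom_surjective K _ x
  induction y using FreeAlgebra.induction with
  | grade0 c => rw [AlgHom.commutes]; exact halg c
  | grade1 i => exact hgen i
  | mul a b ha hb => rw [map_mul]; exact hmul _ _ ha hb
  | add a b ha hb => rw [map_add]; exact hadd _ _ ha hb

theorem span_normalForms (n : ℕ) : Submodule.span K (normalForms n n : Set (Hecke n)) = ⊤ := by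
  rw [eq_top_iff]
  rintro x -
  suffices h : ∀ y ∈ Submodule.span K (normalForms n n : Set (Hecke n)),
      y * x ∈ Submodule.span K (normalForms n n : Set (Hecke n)) by
    simpa using h 1 (one_mem_span_normalForms n n)
  induction x using hecke_induction with
  | halg c =>
    intro y hy
    rw [← Algebra.commutes, ← Algebra.smul_def]
    exact Submodule.smul_mem _ _ hy
  | hgen i =>
    intro y hy
    rw [← genNat_eq i.2]
    exact mul_genNat_mem_span le_rfl i.2.1 i.2.2 hy
  | hmul a b ha hb => intro y hy; rw [← mul_assoc]; exact hb _ (ha _ hy)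
  | hadd a b ha hb => intro y hy; rw [mul_add]; exact add_mem (ha _ hy) (hb _ hy)

/-! ### Bijectivity of the orbit map and the standard basis -/

theorem orbitMap_surjective (n : ℕ) : Function.Surjective (orbitMap n) := by
  rw [← LinearMap.range_eq_top, eq_top_iff]
  rw [← (Finsupp.basisSingleOne (R := K) (ι := Equiv.Perm (Fin n))).span_eq, Submodule.span_le]
  rintro _ ⟨w, rfl⟩
  obtain ⟨l, hl⟩ := exists_reducedWord w
  exact ⟨genProd l, by rw [orbitMap_genProd hl, Finsupp.coe_basisSingleOne]⟩

/-- A dimension count: the Hecke algebra is spanned by at most n! elements and maps onto a space of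
dimension n!. -/
theorem orbitMap_injective (n : ℕ) : Function.Injective (orbitMap n) := by
  have hfin : Module.Finite K (Hecke n) :=
    ⟨⟨normalForms n n, span_normalForms n⟩⟩
  have hle : Module.finrank K (Hecke n) ≤ n.factorial := by
    rw [← finrank_top, ← span_normalForms n]
    exact (finrank_span_finset_le_card _).trans (card_normalForms_le n n)
  have hcard : Module.finrank K (Equiv.Perm (Fin n) →₀ K) = n.factorial := by
    rw [Module.finrank_finsupp_self, Fintype.card_perm, Fintype.card_fin]
  have heq := le_antisymm hle (hcard ▸
    LinearMap.finrank_le_finrank_of_surjective (orbitMap_surjective n))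
  exact (LinearMap.injective_iff_surjective_of_finrank_eq_finrank (heq.trans hcard.symm)).2
    (orbitMap_surjective n)

theorem orbitMap_stdBasis {n : ℕ} (w : Equiv.Perm (Fin n)) :
    orbitMap n (stdBasis w) = Finsupp.single w 1 :=
  orbitMap_genProd (exists_reducedWord w).choose_spec

/-- The product of generators along a reduced word depends only on the permutation. -/
theorem stdBasis_eq_genProd {n : ℕ} {w : Equiv.Perm (Fin n)} {l : List (SimpleIdx n)}
    (h : IsReducedWord l w) : stdBasis w = genProd l :=
  orbitMap_injective n (by rw [orbitMap_stdBasis, orbitMap_genProd h])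

/-- The basis of the Hecke algebra consisting of the `H_w`. -/
noncomputable def heckeBasis (n : ℕ) : Module.Basis (Equiv.Perm (Fin n)) K (Hecke n) :=
  ⟨LinearEquiv.ofBijective (orbitMap n) ⟨orbitMap_injective n, orbitMap_surjective n⟩⟩

theorem heckeBasis_apply {n : ℕ} (w : Equiv.Perm (Fin n)) : heckeBasis n w = stdBasis w := by
  rw [← (heckeBasis n).repr.injective.eq_iff, Module.Basis.repr_self]
  exact (orbitMap_stdBasis w).symm

theorem stdBasis_one {n : ℕ} : stdBasis (1 : Equiv.Perm (Fin n)) = 1 :=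
  stdBasis_eq_genProd (l := []) ⟨rfl, by simp [len_one]⟩

theorem stdBasis_mul_simple {n : ℕ} {w : Equiv.Perm (Fin n)} {i : SimpleIdx n}
    (h : w i.lo < w i.hi) : stdBasis (w * simple i) = stdBasis w * gen i := by
  obtain ⟨l, hl⟩ := exists_reducedWord w
  rw [stdBasis_eq_genProd hl, stdBasis_eq_genProd (l := l ++ [i])]
  · simp [genProd]
  · refine ⟨by rw [wordProd_concat, hl.1], ?_⟩
    rw [len_mul_simple h, List.length_append, hl.2, List.length_singleton]

theorem stdBasis_mul_gen_of_gt {n : ℕ} {w : Equiv.Perm (Fin n)} {i : SimpleIdx n}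
    (h : w i.hi < w i.lo) :
    stdBasis w * gen i = stdBasis (w * simple i) + (v⁻¹ - v) • stdBasis w := by
  have h1 : stdBasis w = stdBasis (w * simple i) * gen i := by
    rw [← stdBasis_mul_simple (by simpa using h), mul_simple_mul_simple]
  conv_lhs => rw [h1]
  rw [mul_assoc, gen_quad, mul_add, mul_one, mul_smul_comm, ← h1, add_comm]

/-! ### Coefficients in `ℤ[v]` and `v ℤ[v]` -/

/-- The subring `ℤ[v]` of `ℂ(v)`. -/
noncomputable def intPoly : Subring K := (Polynomial.aeval (R := ℤ) v).toRingHom.range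

/-- The additive subgroup `v ℤ[v]` of `ℂ(v)`. -/
noncomputable def vIntPoly : AddSubgroup K where
  carrier := {a | ∃ P : Polynomial ℤ, Polynomial.X ∣ P ∧ Polynomial.aeval v P = a}
  zero_mem' := ⟨0, dvd_zero _, map_zero _⟩
  add_mem' := by
    rintro _ _ ⟨P, hP, rfl⟩ ⟨Q, hQ, rfl⟩
    exact ⟨P + Q, dvd_add hP hQ, map_add _ _ _⟩
  neg_mem' := by
    rintro _ ⟨P, hP, rfl⟩
    exact ⟨-P, (dvd_neg).2 hP, map_neg _ _⟩

theorem vIntPoly_le_intPoly {a : K} (h : a ∈ vIntPoly) : a ∈ intPoly := by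
  obtain ⟨P, -, h⟩ := h
  exact ⟨P, h⟩

theorem mul_mem_vIntPoly {a b : K} (ha : a ∈ vIntPoly) (hb : b ∈ intPoly) :
    a * b ∈ vIntPoly := by
  obtain ⟨P, hP, rfl⟩ := ha
  obtain ⟨Q, rfl⟩ := hb
  exact ⟨P * Q, hP.mul_right _, map_mul _ _ _⟩

theorem v_mem_vIntPoly : v ∈ vIntPoly := ⟨Polynomial.X, dvd_rfl, Polynomial.aeval_X _⟩

theorem v_inv_mul_mem_intPoly {a : K} (ha : a ∈ vIntPoly) : v⁻¹ * a ∈ intPoly := by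
  obtain ⟨_, ⟨P, rfl⟩, rfl⟩ := ha
  refine ⟨P, ?_⟩
  have : Polynomial.aeval v (Polynomial.X * P) = v * Polynomial.aeval v P := by
    rw [map_mul, Polynomial.aeval_X]
  rw [this, inv_mul_cancel_left₀ v_ne_zero]
  rfl

theorem v_zpow_mem_vIntPoly {m : ℤ} (hm : 0 < m) : v ^ m ∈ vIntPoly := by
  lift m to ℕ using hm.le
  refine ⟨Polynomial.X ^ m, dvd_pow_self _ (by omega), ?_⟩
  rw [map_pow, Polynomial.aeval_X, zpow_natCast]

/-- Every element of `ℤ[v]` is congruent to an integer modulo `v ℤ[v]`. -/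
theorem exists_int_sub_mem_vIntPoly {a : K} (ha : a ∈ intPoly) :
    ∃ m : ℤ, a - (m : K) ∈ vIntPoly := by
  obtain ⟨P, rfl⟩ := ha
  refine ⟨P.coeff 0, P - Polynomial.C (P.coeff 0), ?_, ?_⟩
  · rw [Polynomial.X_dvd_iff]; simp
  · rw [map_sub, Polynomial.aeval_C, eq_intCast]; rfl

theorem aeval_v_eq (P : Polynomial ℤ) :
    Polynomial.aeval (v : K) P =
      algebraMap (Polynomial ℂ) K (P.map (Int.castRingHom ℂ)) := by
  have h : (Polynomial.aeval (R := ℤ) (v : K)).toRingHom =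
      (algebraMap (Polynomial ℂ) K).comp (Polynomial.mapRingHom (Int.castRingHom ℂ)) := by
    refine Polynomial.ringHom_ext' (RingHom.ext_int _ _) ?_
    simp
  exact RingHom.congr_fun h P

theorem aeval_v_injective : Function.Injective (Polynomial.aeval (R := ℤ) (v : K)) := by
  intro P Q h
  rw [aeval_v_eq, aeval_v_eq] at h
  exact Polynomial.map_injective (Int.castRingHom ℂ) (RingHom.injective_int _)
    (RatFunc.algebraMap_injective ℂ h)

theorem conj_aeval_v (P : Polynomial ℤ) :
    conj (Polynomial.aeval v P) = Polynomial.aeval (v⁻¹ : K) P := by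
  rw [← conj_v]
  exact (Polynomial.aeval_algHom_apply (conj.restrictScalars ℤ) v P).symm

/-- If P(v⁻¹) = P(v), then multiplying by v^d with d = deg P identifies the reverse of P with X^d P.
Degrees force d = 0, and divisibility by X kills the remaining constant. -/
theorem eq_zero_of_conj_eq {a : K} (ha : a ∈ vIntPoly) (hc : conj a = a) : a = 0 := by
  obtain ⟨P, hP, rfl⟩ := ha
  rw [conj_aeval_v] at hc
  have h1 : Polynomial.aeval (v : K) P.reverse = Polynomial.aeval (v : K) (P * Polynomial.X ^ P.natDegree) := by
    rw [map_mul, map_pow, Polynomial.aeval_X, ← hc]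
    have hu : Invertible (v⁻¹ : K) := invertibleOfNonzero (inv_ne_zero v_ne_zero)
    have h2 := Polynomial.eval₂_reverse_mul_pow (Int.castRingHom K) (v⁻¹ : K) P
    have h3 : ⅟(v⁻¹ : K) = v := by rw [invOf_eq_inv, inv_inv]
    rw [h3] at h2
    have h4 : ∀ (y : K) (Q : Polynomial ℤ), Polynomial.aeval y Q = Polynomial.eval₂ (Int.castRingHom K) y Q :=
      fun y Q => by rw [Polynomial.aeval_def]; congr 1; exact RingHom.ext_int _ _
    rw [h4, h4, ← h2, mul_assoc, ← mul_pow, inv_mul_cancel₀ v_ne_zero, one_pow, mul_one]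
  have h2 := aeval_v_injective h1
  by_cases h0 : P = 0
  · rw [h0, map_zero]
  have h3 : P.natDegree = 0 := by
    have h4 := congrArg Polynomial.natDegree h2
    rw [Polynomial.natDegree_mul_X_pow _ h0] at h4
    have := Polynomial.reverse_natDegree_le P
    omega
  rw [Polynomial.eq_C_of_natDegree_eq_zero h3, Polynomial.X_dvd_iff.1 hP]
  simp

/-! ### Existence of the Kazhdan–Lusztig basis -/

theorem bar_smul {n : ℕ} (c : K) (x : Hecke n) : bar n (c • x) = conj c • bar n x := by
  rw [Algebra.smul_def, map_mul, bar_algebraMap, ← Algebra.smul_def]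

/-- The coefficient of `H_y` in `x`. -/
noncomputable def coef {n : ℕ} (y : Equiv.Perm (Fin n)) : Hecke n →ₗ[K] K :=
  (heckeBasis n).coord y

theorem coef_stdBasis {n : ℕ} (y w : Equiv.Perm (Fin n)) :
    coef y (stdBasis w) = if w = y then 1 else 0 := by
  rw [coef, Module.Basis.coord_apply, ← heckeBasis_apply, Module.Basis.repr_self,
    Finsupp.single_apply]

theorem sum_coef {n : ℕ} (x : Hecke n) : ∑ y, coef y x • stdBasis y = x := by
  simpa only [heckeBasis_apply, coef, Module.Basis.coord_apply] using (heckeBasis n).sum_repr x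

theorem coef_mul_gen {n : ℕ} (x : Hecke n) (i : SimpleIdx n) (y : Equiv.Perm (Fin n)) :
    coef y (x * gen i) =
      coef (y * simple i) x + if y i.lo < y i.hi then 0 else (v⁻¹ - v) * coef y x := by
  suffices h : (coef y).comp (LinearMap.mulRight K (gen i)) =
      coef (y * simple i) + (if y i.lo < y i.hi then 0 else (v⁻¹ - v) • coef y) by
    have := LinearMap.congr_fun h x
    rw [LinearMap.comp_apply, LinearMap.mulRight_apply, LinearMap.add_apply] at this
    rw [this]
    split_ifs <;> rfl
  refine (heckeBasis n).ext fun w => ?_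
  rw [heckeBasis_apply, LinearMap.comp_apply, LinearMap.mulRight_apply, LinearMap.add_apply]
  have hiff : w * simple i = y ↔ w = y * simple i := by
    constructor <;> rintro rfl <;> rw [mul_simple_mul_simple]
  rcases lt_or_gt_of_ne (ne_of_simple w i) with h | h
  · rw [← stdBasis_mul_simple h, coef_stdBasis, coef_stdBasis]
    simp only [hiff]
    split_ifs with h1 h2 h2
    · simp
    · rw [LinearMap.smul_apply, coef_stdBasis, if_neg, smul_zero, add_zero]
      rintro rfl
      exact h2 h
    · simp
    · rw [LinearMap.smul_apply, coef_stdBasis, if_neg, smul_zero, add_zero]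
      rintro rfl
      exact h2 h
  · rw [stdBasis_mul_gen_of_gt h, map_add, map_smul, coef_stdBasis, coef_stdBasis, coef_stdBasis]
    simp only [hiff]
    congr 1
    split_ifs with h1 h2 h2
    · subst h1; exact absurd h2 h.not_gt
    · rw [LinearMap.smul_apply, coef_stdBasis, if_pos h1]
    · simp
    · rw [LinearMap.smul_apply, coef_stdBasis, if_neg h1]

/-- `x` satisfies the conditions defining the Kazhdan–Lusztig element `C_w`. -/
structure IsKLElement {n : ℕ} (w : Equiv.Perm (Fin n)) (x : Hecke n) : Prop where
  bar_eq : bar n x = x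
  coef_self : coef w x = 1
  coef_mem : ∀ y, y ≠ w → coef y x ∈ vIntPoly
  coef_support : ∀ y, coef y x ≠ 0 → Relation.ReflTransGen BruhatStep y w

theorem bar_gen_add_v {n : ℕ} (i : SimpleIdx n) :
    bar n (gen i + v • 1) = gen i + v • 1 := by
  rw [map_add, bar_gen, bar_smul, conj_v, map_one, genInv, add_assoc, ← add_smul, sub_add_cancel]

theorem bruhat_cases {n : ℕ} {y w : Equiv.Perm (Fin n)}
    (h : Relation.ReflTransGen BruhatStep y w) : y = w ∨ BruhatLT y w := by
  rcases Relation.reflTransGen_iff_eq_or_transGen.1 h with h | h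
  · exact Or.inl h.symm
  · exact Or.inr h

theorem len_le_of_bruhat {n : ℕ} {y w : Equiv.Perm (Fin n)}
    (h : Relation.ReflTransGen BruhatStep y w) : len y ≤ len w := by
  rcases bruhat_cases h with rfl | h
  · exact le_rfl
  · exact h.len_lt.le

theorem coef_mul_gen_add_v {n : ℕ} (x : Hecke n) (i : SimpleIdx n) (y : Equiv.Perm (Fin n)) :
    coef y (x * (gen i + v • 1)) =
      coef (y * simple i) x + (if y i.lo < y i.hi then v else v⁻¹) * coef y x := by
  rw [mul_add, mul_smul_comm, mul_one, map_add, coef_mul_gen, map_smul, smul_eq_mul]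
  split_ifs <;> ring

section
variable {n : ℕ} {u : Equiv.Perm (Fin n)} {x : Hecke n} {i : SimpleIdx n}

theorem IsKLElement.coef_mul_self (hx : IsKLElement u x) (hu : u i.lo < u i.hi) :
    coef (u * simple i) (x * (gen i + v • 1)) = 1 := by
  rw [coef_mul_gen_add_v, mul_simple_mul_simple, hx.coef_self]
  have h0 : coef (u * simple i) x = 0 := by
    by_contra hne
    have := len_le_of_bruhat (hx.coef_support _ hne)
    rw [len_mul_simple hu] at this
    omega
  rw [h0, mul_zero, add_zero]

/-- The factor v⁻¹ occurs only at right descents y of s_i. Such a y differs from u, so its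
coefficient in x is divisible by v, and the product stays in ℤ[v], possibly with a constant term. -/
theorem IsKLElement.coef_mul_mem (hx : IsKLElement u x) (hu : u i.lo < u i.hi)
    (y : Equiv.Perm (Fin n)) (hy : y ≠ u * simple i) :
    coef y (x * (gen i + v • 1)) ∈ intPoly := by
  rw [coef_mul_gen_add_v]
  refine add_mem (vIntPoly_le_intPoly (hx.coef_mem _ ?_)) ?_
  · rintro rfl
    exact hy (mul_simple_mul_simple _ _).symm
  · by_cases hyu : y = u
    · subst hyu
      rw [if_pos hu, hx.coef_self, mul_one]
      exact vIntPoly_le_intPoly v_mem_vIntPoly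
    · have := hx.coef_mem y hyu
      split_ifs
      · exact mul_mem (vIntPoly_le_intPoly v_mem_vIntPoly) (vIntPoly_le_intPoly this)
      · exact v_inv_mul_mem_intPoly this

theorem IsKLElement.coef_mul_support (hx : IsKLElement u x) (hu : u i.lo < u i.hi)
    (y : Equiv.Perm (Fin n)) (hy : coef y (x * (gen i + v • 1)) ≠ 0) :
    Relation.ReflTransGen BruhatStep y (u * simple i) := by
  rw [coef_mul_gen_add_v] at hy
  by_cases h1 : coef (y * simple i) x = 0
  · have h2 : coef y x ≠ 0 := fun h2 => hy (by rw [h1, h2, mul_zero, add_zero])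
    exact (hx.coef_support y h2).tail (bruhatStep_simple hu)
  · have := bruhat_lifting (hx.coef_support _ h1) hu
    rwa [mul_simple_mul_simple] at this

end

-- The Kazhdan–Lusztig recursion: for a right descent s of w, the element C_{ws}(H_s + v) is
-- bar-invariant with coefficients in ℤ[v]. Subtracting integer multiples of C_z for z ≺ w removes
-- the constant terms without affecting bar-invariance.
open Classical in
theorem exists_isKLElement {n : ℕ} (w : Equiv.Perm (Fin n)) : ∃ x, IsKLElement w x := by
  induction hm : len w using Nat.strong_induction_on generalizing w with
  | _ m ih =>
    by_cases h0 : len w = 0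
    · obtain rfl := eq_one_of_len_eq_zero h0
      refine ⟨1, map_one _, ?_, fun y hy => ?_, fun y hy => ?_⟩ <;>
        rw [← stdBasis_one, coef_stdBasis] at *
      · rw [if_pos rfl]
      · rw [if_neg hy.symm]; exact zero_mem _
      · split_ifs at hy with h
        · rw [h]
        · exact absurd rfl hy
    obtain ⟨i, hi⟩ := exists_descent h0
    have hlen := len_mul_simple_of_gt hi
    obtain ⟨x, hx⟩ := ih _ (by omega) (w * simple i) rfl
    have hu : (w * simple i) i.lo < (w * simple i) i.hi := by simpa using hi
    choose! C hC using fun y (hy : BruhatLT y w) => ih _ (hm ▸ hy.len_lt) y rfl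
    have hself := hx.coef_mul_self hu
    have hmem := hx.coef_mul_mem hu
    have hsupp := hx.coef_mul_support hu
    rw [mul_simple_mul_simple] at hself hmem hsupp
    -- The integer c y is the constant term of the coefficient at y.
    choose! c hc using fun y (hy : y ≠ w) => exists_int_sub_mem_vIntPoly (hmem y hy)
    have hcoef : ∀ y, coef y (x * (gen i + v • 1) - ∑ z with BruhatLT z w, (c z : K) • C z)
        = coef y (x * (gen i + v • 1)) - ∑ z with BruhatLT z w, (c z : K) * coef y (C z) := by
      intro y
      simp [map_sub, map_sum]
    refine ⟨x * (gen i + v • 1) - ∑ z with BruhatLT z w, (c z : K) • C z, ?_, ?_, ?_, ?_⟩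
    · rw [map_sub, map_mul, hx.bar_eq, bar_gen_add_v, map_sum]
      congr 1
      refine Finset.sum_congr rfl fun z hz => ?_
      rw [bar_smul, (hC z (Finset.mem_filter.1 hz).2).bar_eq, map_intCast]
    · rw [hcoef, hself, Finset.sum_eq_zero, sub_zero]
      intro z hz
      have hz := (Finset.mem_filter.1 hz).2
      by_contra hne
      have h1 := len_le_of_bruhat ((hC z hz).coef_support w (right_ne_zero_of_mul hne))
      have := hz.len_lt
      omega
    · intro y hy
      rw [hcoef]
      by_cases hyw : BruhatLT y w
      -- The term z = y cancels the constant term at y; every other C_z contributes only an element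
      -- of v ℤ[v] there.
      · rw [← Finset.add_sum_erase _ _ (Finset.mem_filter.2 ⟨Finset.mem_univ y, hyw⟩),
          (hC y hyw).coef_self, mul_one, ← sub_sub]
        refine sub_mem (hc y hy) (sum_mem fun z hz => ?_)
        obtain ⟨hzy, hz⟩ := Finset.mem_erase.1 hz
        rw [mul_comm]
        exact mul_mem_vIntPoly ((hC z (Finset.mem_filter.1 hz).2).coef_mem y hzy.symm)
          (intCast_mem _ _)
      · have h1 : coef y (x * (gen i + v • 1)) = 0 := by
          by_contra hne
          exact (bruhat_cases (hsupp y hne)).elim hy hyw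
        rw [h1, Finset.sum_eq_zero, sub_zero]
        · exact zero_mem _
        · intro z hz
          have hz := (Finset.mem_filter.1 hz).2
          by_contra hne
          rcases bruhat_cases ((hC z hz).coef_support y (right_ne_zero_of_mul hne)) with rfl | h
          · exact hyw hz
          · exact hyw (h.trans hz)
    · intro y hy
      rw [hcoef] at hy
      by_cases h1 : coef y (x * (gen i + v • 1)) = 0
      · rw [h1, zero_sub, neg_ne_zero] at hy
        obtain ⟨z, hz, hne⟩ := Finset.exists_ne_zero_of_sum_ne_zero hy
        have hz := (Finset.mem_filter.1 hz).2
        exact ((hC z hz).coef_support y (right_ne_zero_of_mul hne)).trans hz.to_reflTransGen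
      · exact hsupp y h1

/-- A family of Kazhdan–Lusztig elements. -/
noncomputable def klElement {n : ℕ} (w : Equiv.Perm (Fin n)) : Hecke n :=
  (exists_isKLElement w).choose

theorem isKLElement_klElement {n : ℕ} (w : Equiv.Perm (Fin n)) : IsKLElement w (klElement w) :=
  (exists_isKLElement w).choose_spec

theorem stdBasis_eq_klElement_sub {n : ℕ} (w : Equiv.Perm (Fin n)) :
    stdBasis w = klElement w -
      ∑ y ∈ Finset.univ.erase w, coef y (klElement w) • stdBasis y := by
  have h := sum_coef (klElement w)
  rw [← Finset.add_sum_erase _ _ (Finset.mem_univ w), (isKLElement_klElement w).coef_self,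
    one_smul] at h
  exact eq_sub_of_add_eq h

theorem len_lt_of_coef_klElement_ne_zero {n : ℕ} {y w : Equiv.Perm (Fin n)} (hy : y ≠ w)
    (h : coef y (klElement w) ≠ 0) : len y < len w :=
  ((bruhat_cases ((isKLElement_klElement w).coef_support y h)).resolve_left hy).len_lt

theorem stdBasis_mem_span_klElement {n : ℕ} (w : Equiv.Perm (Fin n)) :
    stdBasis w ∈ Submodule.span K (Set.range (klElement (n := n))) := by
  induction hm : len w using Nat.strong_induction_on generalizing w with
  | _ m ih =>
    rw [stdBasis_eq_klElement_sub]
    refine sub_mem (Submodule.subset_span ⟨w, rfl⟩) (sum_mem fun y hy => ?_)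
    by_cases h : coef y (klElement w) = 0
    · rw [h, zero_smul]; exact zero_mem _
    · exact Submodule.smul_mem _ _ (ih _
        (hm ▸ len_lt_of_coef_klElement_ne_zero (Finset.ne_of_mem_erase hy) h) y rfl)

theorem span_klElement (n : ℕ) : Submodule.span K (Set.range (klElement (n := n))) = ⊤ := by
  rw [eq_top_iff, ← (heckeBasis n).span_eq, Submodule.span_le]
  rintro _ ⟨w, rfl⟩
  rw [heckeBasis_apply]
  exact stdBasis_mem_span_klElement w

theorem linearIndependent_klElement (n : ℕ) : LinearIndependent K (klElement (n := n)) :=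
  linearIndependent_of_top_le_span_of_card_eq_finrank (span_klElement n).ge
    (Module.finrank_eq_card_basis (heckeBasis n)).symm

theorem isKLBasis_klElement (n : ℕ) : IsKLBasis n klElement where
  linearIndependent := linearIndependent_klElement n
  span_eq_top := span_klElement n
  bar_invariant w := (isKLElement_klElement w).bar_eq
  unitriangular w := by
    classical
    have hw := isKLElement_klElement w
    choose! P hP using fun y (hy : BruhatLT y w) => hw.coef_mem y (by
      rintro rfl
      exact lt_irrefl _ hy.len_lt)
    refine ⟨P, fun y hy => (hP y hy).1, ?_⟩
    have hsum : ∑ y with BruhatLT y w, Polynomial.aeval v (P y) • stdBasis y =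
        ∑ y ∈ Finset.univ.erase w, coef y (klElement w) • stdBasis y := by
      rw [Finset.sum_congr rfl fun y hy => by rw [(hP y (Finset.mem_filter.1 hy).2).2]]
      refine Finset.sum_subset (fun y hy => ?_) fun y hy hy' => ?_
      · refine Finset.mem_erase.2 ⟨?_, Finset.mem_univ _⟩
        rintro rfl
        exact lt_irrefl _ (Finset.mem_filter.1 hy).2.len_lt
      · by_contra hne
        rcases bruhat_cases (hw.coef_support y (left_ne_zero_of_smul hne)) with h | h
        · exact Finset.ne_of_mem_erase hy h
        · exact hy' (Finset.mem_filter.2 ⟨Finset.mem_univ _, h⟩)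
    rw [hsum]
    exact eq_add_of_sub_eq (stdBasis_eq_klElement_sub w).symm

/-! ### Uniqueness of the Kazhdan–Lusztig basis -/

/-- The basis of the Kazhdan–Lusztig elements. -/
noncomputable def klModuleBasis (n : ℕ) :
    Module.Basis (Equiv.Perm (Fin n)) K (Hecke n) :=
  Module.Basis.mk (linearIndependent_klElement n) (span_klElement n).ge

theorem klModuleBasis_apply {n : ℕ} (w : Equiv.Perm (Fin n)) :
    klModuleBasis n w = klElement w :=
  Module.Basis.mk_apply _ _ _

/-- Inverting the unitriangular change of basis, by induction on length, keeps coefficients in v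
ℤ[v]. -/
theorem repr_smul_stdBasis_mem {n : ℕ} {a : K} (ha : a ∈ vIntPoly) (w y : Equiv.Perm (Fin n)) :
    (klModuleBasis n).repr (a • stdBasis w) y ∈ vIntPoly := by
  induction hm : len w using Nat.strong_induction_on generalizing w a with
  | _ m ih =>
    rw [stdBasis_eq_klElement_sub, smul_sub, Finset.smul_sum, map_sub, map_smul, map_sum,
      ← klModuleBasis_apply, Module.Basis.repr_self, Finsupp.sub_apply, Finsupp.smul_apply,
      Finsupp.finsetSum_apply]
    refine sub_mem ?_ (sum_mem fun z hz => ?_)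
    · rw [Finsupp.single_apply, smul_eq_mul]
      split_ifs
      · rwa [mul_one]
      · rw [mul_zero]; exact zero_mem _
    · have hzw := Finset.ne_of_mem_erase hz
      rw [klModuleBasis_apply, smul_smul]
      by_cases h : coef z (klElement w) = 0
      · rw [h, mul_zero, zero_smul, map_zero]; exact zero_mem _
      · exact ih _ (hm ▸ len_lt_of_coef_klElement_ne_zero hzw h) (mul_mem_vIntPoly ha
          (vIntPoly_le_intPoly ((isKLElement_klElement w).coef_mem z hzw))) z rfl

/-- In the bar-invariant basis `klElement`, the coordinates of x lie in v ℤ[v] and are fixed by v ↦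
v⁻¹, so they vanish. -/
theorem eq_zero_of_bar_eq {n : ℕ} {x : Hecke n} (hx : bar n x = x)
    (hmem : ∀ y, coef y x ∈ vIntPoly) : x = 0 := by
  have h1 : ∀ y, (klModuleBasis n).repr x y ∈ vIntPoly := by
    intro y
    rw [← sum_coef x, map_sum, Finsupp.finsetSum_apply]
    exact sum_mem fun w _ => repr_smul_stdBasis_mem (hmem w) w y
  have h2 : ∀ y, conj ((klModuleBasis n).repr x y) = (klModuleBasis n).repr x y := by
    intro y
    have h3 : bar n x = ∑ w, conj ((klModuleBasis n).repr x w) • klModuleBasis n w := by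
      conv_lhs => rw [← (klModuleBasis n).sum_repr x]
      rw [map_sum]
      refine Finset.sum_congr rfl fun w _ => ?_
      rw [bar_smul, klModuleBasis_apply, (isKLElement_klElement w).bar_eq]
    rw [hx] at h3
    conv_rhs => rw [h3, Module.Basis.repr_sum_self]
  refine (klModuleBasis n).repr.injective (Finsupp.ext fun y => ?_)
  rw [map_zero, Finsupp.zero_apply]
  exact eq_zero_of_conj_eq (h1 y) (h2 y)

open Classical in
/-- A bar-invariant element of `H_w + ∑_y v ℤ[v] H_y` is the Kazhdan–Lusztig element `C_w`. -/
theorem klBasis_eq_of_bar_eq {n : ℕ} {w : Equiv.Perm (Fin n)} {x : Hecke n}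
    (hx : bar n x = x) (hmem : ∀ y, coef y (x - stdBasis w) ∈ vIntPoly) : klBasis w = x := by
  -- This is where the existence of a Kazhdan–Lusztig basis gives the `epsilon` choice its defining
  -- properties.
  have hC : IsKLBasis n klBasis := Classical.epsilon_spec ⟨_, isKLBasis_klElement n⟩
  rw [← sub_eq_zero]
  refine eq_zero_of_bar_eq (by rw [map_sub, hC.bar_invariant, hx]) fun y => ?_
  obtain ⟨P, hP, hw⟩ := hC.unitriangular w
  rw [← sub_sub_sub_cancel_right _ _ (stdBasis w), map_sub]
  refine sub_mem ?_ (hmem y)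
  rw [hw, add_sub_cancel_left, map_sum]
  refine sum_mem fun z hz => ?_
  rw [map_smul, coef_stdBasis, smul_eq_mul]
  have h : Polynomial.aeval v (P z) ∈ vIntPoly := ⟨P z, hP z (Finset.mem_filter.1 hz).2, rfl⟩
  split_ifs
  · rwa [mul_one]
  · rw [mul_zero]; exact zero_mem _

/-! ### Multiplying by `∑_q v^{l-q} H_J ⋯ H_{J-q+1}` -/

/-- The element `∑_{q ≤ l} v^{l-q} H_J H_{J-1} ⋯ H_{J-q+1}`. -/
noncomputable def descSum (n J l : ℕ) : Hecke n :=
  ∑ q ∈ Finset.range (l + 1), v ^ (l - q) • descProd n J q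

theorem descSum_zero (n J : ℕ) : descSum n J 0 = 1 := by simp [descSum]

theorem descSum_succ (n J l : ℕ) :
    descSum n J (l + 1) = v • descSum n J l + descProd n J (l + 1) := by
  rw [descSum, Finset.sum_range_succ, Nat.sub_self, pow_zero, one_smul, descSum, Finset.smul_sum]
  congr 1
  refine Finset.sum_congr rfl fun q hq => ?_
  have hq' := Finset.mem_range.1 hq
  rw [smul_smul, ← pow_succ', show l + 1 - q = l - q + 1 by omega]

theorem descSum_mul_genNat_far {n J l i : ℕ} (h : l + i < J) :
    descSum n J l * genNat n i = genNat n i * descSum n J l := by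
  rw [descSum, Finset.sum_mul, Finset.mul_sum]
  refine Finset.sum_congr rfl fun q hq => ?_
  have hq' := Finset.mem_range.1 hq
  rw [smul_mul_assoc, mul_smul_comm, descProd_mul_genNat_far (by omega)]

section
variable {n J : ℕ} {X : Hecke n}

/-- With h = H_{J-l-1} and S_l = `descSum n J l`, the relation S_{l+1} = v S_l + D_{l+1} gives X
S_{l+1} h = v X S_l h + X D_{l+2}. Since h commutes with S_l and X h = v⁻¹ X, the first summand is X
S_l. The recursion writes X S_{l+2} through bar-invariant factors. -/
theorem mul_descSum_add_two {l : ℕ} (hl : l + 2 ≤ J)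
    (hX : X * genNat n (J - (l + 1)) = v⁻¹ • X) :
    X * descSum n J (l + 2) = X * descSum n J (l + 1) * (genNat n (J - (l + 1)) + v • 1)
      - X * descSum n J l := by
  have h1 : X * descSum n J (l + 1) * genNat n (J - (l + 1)) =
      X * descSum n J l + X * descProd n J (l + 2) := by
    rw [mul_assoc, descSum_succ, add_mul, ← descProd_succ, smul_mul_assoc,
      descSum_mul_genNat_far (by omega), mul_add, mul_smul_comm, ← mul_assoc, hX, smul_mul_assoc,
      smul_smul, mul_inv_cancel₀ v_ne_zero, one_smul]
  rw [mul_add, h1, mul_smul_comm, mul_one, descSum_succ n J (l + 1), mul_add, mul_smul_comm]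
  abel

theorem bar_mul_descSum {l : ℕ} (hJ : J < n) (hl : l ≤ J) (hbar : bar n X = X)
    (hX : ∀ i, 1 ≤ i → J < l + i → i < J → X * genNat n i = v⁻¹ • X) :
    bar n (X * descSum n J l) = X * descSum n J l := by
  have hg : ∀ i, 1 ≤ i → i < n → bar n (genNat n i + v • 1) = genNat n i + v • 1 := by
    intro i h1 h2
    rw [genNat_eq ⟨h1, h2⟩, bar_gen_add_v]
  induction l using Nat.twoStepInduction with
  | zero => rw [descSum_zero, mul_one, hbar]
  | one =>
    have h1 : descSum n J 1 = genNat n J + v • 1 := by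
      rw [descSum_succ, descSum_zero, descProd_succ, descProd_zero, one_mul, Nat.sub_zero, add_comm]
    rw [map_mul, hbar, h1, hg J (by omega) hJ]
  | more l ih0 ih1 =>
    rw [mul_descSum_add_two hl (hX _ (by omega) (by omega) (by omega)), map_sub, map_mul,
      hg _ (by omega) (by omega), ih0 (by omega) fun i h1 h2 h3 => hX i h1 (by omega) h3,
      ih1 (by omega) fun i h1 h2 h3 => hX i h1 (by omega) h3]

/-- Splitting S_{l+1} = v S_l + D_{l+1}, an index i > J - l is handled by induction on the first
part; on the second H_i passes through D_{l+1} as H_{i-1}, which X absorbs. The new index i = J - l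
is treated separately. -/
theorem mul_descSum_mul_genNat {l i : ℕ} (hJ : J < n) (hl : l ≤ J)
    (hX : ∀ i, 1 ≤ i → J < l + i → i < J → X * genNat n i = v⁻¹ • X)
    (h1 : 1 ≤ i) (h2 : J < l + i) (h3 : i ≤ J) :
    X * descSum n J l * genNat n i = v⁻¹ • (X * descSum n J l) := by
  induction l with
  | zero => omega
  | succ l ih =>
    by_cases hi : J < l + i
    · obtain ⟨i, rfl⟩ : ∃ i', i = i' + 1 := ⟨i - 1, by omega⟩
      rw [descSum_succ, mul_add, mul_smul_comm, add_mul, smul_mul_assoc,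
        ih (by omega) (fun i h1 h2 h3 => hX i h1 (by omega) h3) hi, mul_assoc X,
        descProd_mul_genNat_mem (by omega) (by omega) (by omega) hl hJ, ← mul_assoc,
        hX i (by omega) (by omega) (by omega), smul_mul_assoc, smul_add, smul_comm v]
    · obtain rfl : i = J - l := by omega
      -- The two longest summands already form a v⁻¹-eigenvector of H_{J-l}, by the quadratic
      -- relation and without help from X.
      have htop : (v • descProd n J l + descProd n J (l + 1)) * genNat n (J - l) =
          v⁻¹ • (v • descProd n J l + descProd n J (l + 1)) := by
        rw [add_mul, descProd_mul_genNat_self (by omega) hJ, smul_mul_assoc, ← descProd_succ,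
          smul_add, smul_smul v⁻¹ v, inv_mul_cancel₀ v_ne_zero, one_smul, sub_smul]
        abel
      cases l with
      | zero =>
        rw [descSum_succ, descSum_zero, ← descProd_zero n J, mul_assoc, htop, mul_smul_comm]
      | succ l =>
        -- All shorter summands commute with H_{J-(l+1)}, so there the generator reaches X and is
        -- absorbed.
        have e : descSum n J (l + 1 + 1) = (v * v) • descSum n J l +
            (v • descProd n J (l + 1) + descProd n J (l + 1 + 1)) := by
          rw [descSum_succ, descSum_succ, smul_add, smul_smul, add_assoc]
        rw [e, mul_add, add_mul, mul_assoc X (v • _ + _), htop, mul_smul_comm (v * v) X,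
          smul_mul_assoc, mul_assoc X, descSum_mul_genNat_far (by omega), ← mul_assoc,
          hX _ h1 h2 (by omega), smul_mul_assoc, mul_smul_comm, smul_add, smul_comm (v * v)]

end

/-- Products of the elements `descSum` for a weakly decreasing sequence. -/
theorem mul_prod_descSum {n k m : ℕ} (hkm : k + m ≤ n) {X : Hecke n} (hbar : bar n X = X)
    (hX : ∀ i, 1 ≤ i → i < k → X * genNat n i = v⁻¹ • X) (f : Fin m → ℕ) (hf : Antitone f)
    (hfk : ∀ i, f i ≤ k) :
    bar n (X * (List.ofFn fun i => descSum n (k + i.1) (f i)).prod) =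
        X * (List.ofFn fun i => descSum n (k + i.1) (f i)).prod ∧
      ∀ l ≤ k, (∀ i, l ≤ f i) → ∀ i, 1 ≤ i → k + m < l + i → i < k + m →
        X * (List.ofFn fun i => descSum n (k + i.1) (f i)).prod * genNat n i =
          v⁻¹ • (X * (List.ofFn fun i => descSum n (k + i.1) (f i)).prod) := by
  induction m with
  | zero =>
    simp only [List.ofFn_zero, List.prod_nil, mul_one]
    exact ⟨hbar, fun l hl _ i h1 h2 h3 => hX i h1 (by omega)⟩
  | succ m ih =>
    obtain ⟨h1, h2⟩ := ih (by omega) (fun i => f i.castSucc)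
      (fun i j hij => hf (Fin.castSucc_le_castSucc_iff.2 hij)) (fun i => hfk _)
    rw [List.ofFn_succ', List.prod_concat, ← mul_assoc]
    simp only [Fin.val_castSucc, Fin.val_last]
    -- The eigenvector range is indexed by any lower bound l of the earlier values. Antitonicity
    -- makes the new last value such a bound, and the empty product needs no separate last value.
    have h3 := h2 (f (Fin.last m)) (hfk _) fun i => hf (Fin.le_last _)
    have hk := hfk (Fin.last m)
    refine ⟨bar_mul_descSum (by omega) (by omega) h1 h3, fun l hl hlf i hi1 hi2 hi3 => ?_⟩
    have := hlf (Fin.last m)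
    exact mul_descSum_mul_genNat (by omega) (by omega) h3 hi1 (by omega) (by omega)

/-! ### The permutations `t^∨` -/

theorem tVee_succ (n J q : ℕ) : tVee n (J + 1) (q + 1) = tVee n (J + 1) q * simpleNat n (J - q) := by
  simp [tVee, List.range_succ]

theorem tVee_zero (n J : ℕ) : tVee n J 0 = 1 := rfl

theorem simpleNat_of_ne {n i : ℕ} {x : Fin n} (h1 : x.1 + 1 ≠ i) (h2 : x.1 ≠ i) :
    simpleNat n i x = x := by
  unfold simpleNat
  split_ifs with h
  · apply simple_of_ne <;> rw [ne_eq, Fin.ext_iff] <;> simp only [SimpleIdx.lo, SimpleIdx.hi] <;>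
      omega
  · rfl

theorem simpleNat_eq {n i : ℕ} (h : 1 ≤ i ∧ i < n) : simpleNat n i = simple ⟨i, h⟩ := dif_pos h

theorem tVee_apply_of_lt {n J q : ℕ} {x : Fin n} (h : x.1 + q < J) : tVee n (J + 1) q x = x := by
  induction q with
  | zero => rfl
  | succ q ih =>
    rw [tVee_succ, Equiv.Perm.mul_apply, simpleNat_of_ne (by omega) (by omega), ih (by omega)]

theorem tVee_apply_of_gt {n J q : ℕ} {x : Fin n} (h : J < x.1) : tVee n (J + 1) q x = x := by
  induction q with
  | zero => rfl
  | succ q ih =>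
    rw [tVee_succ, Equiv.Perm.mul_apply, simpleNat_of_ne (by omega) (by omega), ih]

theorem tVee_apply_eq {n J q : ℕ} (hJ : J < n) {x : Fin n} (h : x.1 + q = J) :
    tVee n (J + 1) q x = ⟨J, hJ⟩ := by
  induction q generalizing x with
  | zero => exact Fin.ext h
  | succ q ih =>
    have hi : 1 ≤ J - q ∧ J - q < n := by omega
    have hx : x = SimpleIdx.lo ⟨J - q, hi⟩ := by
      rw [Fin.ext_iff]; simp only [SimpleIdx.lo]; omega
    rw [tVee_succ, Equiv.Perm.mul_apply, simpleNat_eq hi, hx, simple_lo]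
    exact ih (by simp only [SimpleIdx.hi]; omega)

/-- `w` fixes all elements `≥ j` of `Fin n`. -/
def FixesFrom {n : ℕ} (j : ℕ) (w : Equiv.Perm (Fin n)) : Prop := ∀ x : Fin n, j ≤ x.1 → w x = x

theorem fixesFrom_one {n : ℕ} (j : ℕ) : FixesFrom j (1 : Equiv.Perm (Fin n)) := fun _ _ => rfl

theorem FixesFrom.apply_lt {n j : ℕ} {w : Equiv.Perm (Fin n)} (h : FixesFrom j w) {x : Fin n}
    (hx : x.1 < j) : (w x).1 < j := by
  by_contra hcon
  have h1 := w.injective (h (w x) (not_lt.1 hcon))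
  rw [h1] at hcon
  exact hcon hx

/-- Before s_{J-q} is appended, its right position is sent to J and its left position to something
below J. Each factor therefore raises the length by one, and H multiplies accordingly. -/
theorem FixesFrom.mul_tVee {n J q : ℕ} (hJ : J < n) (hq : q ≤ J) {w : Equiv.Perm (Fin n)}
    (h : FixesFrom J w) :
    FixesFrom (J + 1) (w * tVee n (J + 1) q) ∧ len (w * tVee n (J + 1) q) = len w + q ∧
      stdBasis (w * tVee n (J + 1) q) = stdBasis w * descProd n J q := by
  refine ⟨fun x hx => ?_, ?_⟩
  · rw [Equiv.Perm.mul_apply, tVee_apply_of_gt (by omega), h x (by omega)]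
  induction q with
  | zero => simp [tVee_zero]
  | succ q ih =>
    obtain ⟨h1, h2⟩ := ih (by omega)
    have hi : 1 ≤ J - q ∧ J - q < n := by omega
    have hlt : (w * tVee n (J + 1) q) (SimpleIdx.lo ⟨J - q, hi⟩) <
        (w * tVee n (J + 1) q) (SimpleIdx.hi ⟨J - q, hi⟩) := by
      rw [Equiv.Perm.mul_apply, Equiv.Perm.mul_apply,
        tVee_apply_of_lt (by simp only [SimpleIdx.lo]; omega),
        tVee_apply_eq hJ (by simp only [SimpleIdx.hi]; omega), h ⟨J, hJ⟩ le_rfl]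
      exact h.apply_lt (by simp only [SimpleIdx.lo]; omega)
    rw [tVee_succ, ← mul_assoc, simpleNat_eq hi, len_mul_simple hlt, stdBasis_mul_simple hlt, h1,
      h2, descProd_succ, genNat_eq hi, mul_assoc]
    exact ⟨rfl, rfl⟩

theorem FixesFrom.mul_prod_tVee {n k m : ℕ} (hkm : k + m ≤ n) {w : Equiv.Perm (Fin n)}
    (h : FixesFrom k w) (f : Fin m → ℕ) (hf : ∀ i, f i ≤ k + i.1) :
    FixesFrom (k + m) (w * (List.ofFn fun i => tVee n (k + i.1 + 1) (f i)).prod) ∧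
      len (w * (List.ofFn fun i => tVee n (k + i.1 + 1) (f i)).prod) = len w + ∑ i, f i ∧
      stdBasis (w * (List.ofFn fun i => tVee n (k + i.1 + 1) (f i)).prod) =
        stdBasis w * (List.ofFn fun i => descProd n (k + i.1) (f i)).prod := by
  induction m with
  | zero => simpa using h
  | succ m ih =>
    obtain ⟨h1, h2, h3⟩ := ih (by omega) (fun i => f i.castSucc) (fun i => hf i.castSucc)
    rw [List.ofFn_succ', List.ofFn_succ', List.prod_concat, List.prod_concat, ← mul_assoc,
      ← mul_assoc, Fin.sum_univ_castSucc]
    simp only [Fin.val_castSucc, Fin.val_last]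
    obtain ⟨h4, h5, h6⟩ := h1.mul_tVee (J := k + m) (q := f (Fin.last m)) (by omega) (hf (Fin.last m))
    exact ⟨h4, by rw [h5, h2, add_assoc], by rw [h6, h3]⟩

/-! ### The parabolic subgroup `W_k` -/

/-- The number q is the distance from J back to w⁻¹(J); removing `tVee n (J + 1) q` makes J a fixed
point. This is the coset decomposition of S_{J+1} over S_J. -/
theorem FixesFrom.exists_mul_tVee {n J : ℕ} (hJ : J < n) {w : Equiv.Perm (Fin n)}
    (h : FixesFrom (J + 1) w) :
    ∃ u : Equiv.Perm (Fin n), ∃ q ≤ J, FixesFrom J u ∧ u * tVee n (J + 1) q = w := by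
  have hw : w (w⁻¹ ⟨J, hJ⟩) = ⟨J, hJ⟩ := w.apply_symm_apply _
  have hle : (w⁻¹ ⟨J, hJ⟩).1 ≤ J := by
    by_contra hcon
    have h1 := h (w⁻¹ ⟨J, hJ⟩) (by omega)
    rw [hw] at h1
    rw [← h1] at hcon
    exact hcon le_rfl
  refine ⟨w * (tVee n (J + 1) (J - (w⁻¹ ⟨J, hJ⟩).1))⁻¹, J - (w⁻¹ ⟨J, hJ⟩).1, by omega, ?_, by simp⟩
  intro x hx
  rw [Equiv.Perm.mul_apply]
  rcases hx.eq_or_lt with hx | hx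
  · have hxe : x = ⟨J, hJ⟩ := Fin.ext hx.symm
    have h1 : (tVee n (J + 1) (J - (w⁻¹ ⟨J, hJ⟩).1))⁻¹ x = w⁻¹ ⟨J, hJ⟩ :=
      Equiv.Perm.inv_eq_iff_eq.2 (by rw [tVee_apply_eq hJ (by omega), hxe])
    rw [h1, hw, hxe]
  · rw [Equiv.Perm.inv_eq_iff_eq.2 (tVee_apply_of_gt hx).symm, h x hx]

theorem tVee_mem_parabolic {n J q : ℕ} (hJ : J < n) (hq : q ≤ J) :
    tVee n (J + 1) q ∈ parabolic n (J + 1) := by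
  induction q with
  | zero => exact one_mem _
  | succ q ih =>
    have hi : 1 ≤ J - q ∧ J - q < n := by omega
    rw [tVee_succ, simpleNat_eq hi]
    exact mul_mem (ih (by omega)) (Subgroup.subset_closure ⟨_, by dsimp only; omega, rfl⟩)

theorem parabolic_mono (n : ℕ) {j k : ℕ} (h : j ≤ k) : parabolic n j ≤ parabolic n k :=
  Subgroup.closure_mono fun _ ⟨i, hi, hs⟩ => ⟨i, by omega, hs⟩

theorem FixesFrom.mem_parabolic {n k : ℕ} (hk : k ≤ n) {w : Equiv.Perm (Fin n)}
    (h : FixesFrom k w) : w ∈ parabolic n k := by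
  induction k generalizing w with
  | zero =>
    rw [Equiv.ext (g := (1 : Equiv.Perm (Fin n))) fun x => h x (Nat.zero_le _)]
    exact one_mem _
  | succ k ih =>
    obtain ⟨u, q, hq, hu, rfl⟩ := h.exists_mul_tVee (by omega)
    exact mul_mem (parabolic_mono n (Nat.le_succ k) (ih (by omega) hu))
      (tVee_mem_parabolic (by omega) hq)

theorem fixesFrom_of_mem_parabolic {n k : ℕ} {w : Equiv.Perm (Fin n)}
    (h : w ∈ parabolic n k) : FixesFrom k w := by
  induction h using Subgroup.closure_induction with
  | mem x hx =>
    obtain ⟨i, hi, rfl⟩ := hx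
    intro y hy
    apply simple_of_ne <;> rw [ne_eq, Fin.ext_iff] <;> simp only [SimpleIdx.lo, SimpleIdx.hi] <;>
      omega
  | one => exact fun _ _ => rfl
  | mul x y _ _ hx hy => intro a ha; rw [Equiv.Perm.mul_apply, hy a ha, hx a ha]
  | inv x _ hx => intro a ha; rw [Equiv.Perm.inv_eq_iff_eq, hx a ha]

theorem mem_parabolicFinset {n k : ℕ} (hk : k ≤ n) {w : Equiv.Perm (Fin n)} :
    w ∈ parabolicFinset n k ↔ FixesFrom k w := by
  rw [parabolicFinset, Set.Finite.mem_toFinset, SetLike.mem_coe]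
  exact ⟨fixesFrom_of_mem_parabolic, fun h => h.mem_parabolic hk⟩

/-- Lengths add in w = u t^∨_{k+1,q}, so the maximum is attained exactly when u is longest and q =
k. The strict bound for all other elements later makes the exponents of v positive. -/
theorem exists_longest {n k : ℕ} (hk : k ≤ n) :
    ∃ w₀ : Equiv.Perm (Fin n), FixesFrom k w₀ ∧ len w₀ = ∑ i ∈ Finset.range k, i ∧
      ∀ w, FixesFrom k w → w ≠ w₀ → len w < ∑ i ∈ Finset.range k, i := by
  induction k with
  | zero =>
    refine ⟨1, fixesFrom_one 0, len_one, fun w hw hne => absurd ?_ hne⟩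
    exact Equiv.ext fun x => hw x (Nat.zero_le _)
  | succ k ih =>
    obtain ⟨w₀, h1, h2, h3⟩ := ih (by omega)
    obtain ⟨h4, h5, -⟩ := h1.mul_tVee (q := k) (by omega) le_rfl
    refine ⟨_, h4, by rw [h5, h2, Finset.sum_range_succ], fun w hw hne => ?_⟩
    obtain ⟨u, q, hq, hu, rfl⟩ := hw.exists_mul_tVee (by omega)
    rw [(hu.mul_tVee (by omega) hq).2.1, Finset.sum_range_succ]
    by_cases huw : u = w₀
    · subst huw
      have : q ≠ k := by rintro rfl; exact hne rfl
      omega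
    · have := h3 u hu huw
      omega

theorem IsLongest.len_eq {n k : ℕ} (hk : k ≤ n) {wk : Equiv.Perm (Fin n)} (h : IsLongest k wk) :
    len wk = ∑ i ∈ Finset.range k, i ∧
      ∀ w, FixesFrom k w → w ≠ wk → len w < ∑ i ∈ Finset.range k, i := by
  obtain ⟨w₀, h1, h2, h3⟩ := exists_longest hk
  have heq : wk = w₀ := by
    by_contra hne
    have h4 := h3 wk (fixesFrom_of_mem_parabolic h.1) hne
    have h5 := h.2 w₀ (h1.mem_parabolic hk)
    omega
  subst heq
  exact ⟨h2, h3⟩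

/-- The element `∑_{w ∈ W_k} v^{ℓ(w_k) - ℓ(w)} H_w`. -/
noncomputable def parabolicSum (n k : ℕ) : Hecke n :=
  ∑ w ∈ parabolicFinset n k, v ^ (((∑ i ∈ Finset.range k, i : ℕ) : ℤ) - (len w : ℤ)) • stdBasis w

theorem parabolicSum_zero (n : ℕ) : parabolicSum n 0 = 1 := by
  have h : parabolicFinset n 0 = {1} := by
    ext w
    rw [mem_parabolicFinset (Nat.zero_le _), Finset.mem_singleton]
    exact ⟨fun h => Equiv.ext fun x => h x (Nat.zero_le _), by rintro rfl; exact fixesFrom_one 0⟩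
  simp [parabolicSum, h, len_one, stdBasis_one]

theorem parabolicSum_succ {n k : ℕ} (hk : k < n) :
    parabolicSum n (k + 1) = parabolicSum n k * descSum n k k := by
  rw [parabolicSum, parabolicSum, descSum, Finset.sum_mul_sum, ← Finset.sum_product']
  symm
  refine Finset.sum_bij (fun p _ => p.1 * tVee n (k + 1) p.2) ?_ ?_ ?_ ?_
  · rintro ⟨w, q⟩ hp
    rw [Finset.mem_product, mem_parabolicFinset hk.le, Finset.mem_range] at hp
    rw [mem_parabolicFinset hk]
    exact (hp.1.mul_tVee hk (by omega)).1
  · rintro ⟨w, q⟩ hp ⟨w', q'⟩ hp' heq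
    rw [Finset.mem_product, mem_parabolicFinset hk.le, Finset.mem_range] at hp hp'
    dsimp only at hp hp' heq
    -- The value k is attained at position k - q, so the product determines q.
    have h1 : (⟨k - q, by omega⟩ : Fin n) = ⟨k - q', by omega⟩ := by
      apply (w * tVee n (k + 1) q).injective
      conv_rhs => rw [heq]
      rw [Equiv.Perm.mul_apply, Equiv.Perm.mul_apply, tVee_apply_eq hk (by dsimp only; omega),
        tVee_apply_eq hk (by dsimp only; omega), hp.1 _ le_rfl, hp'.1 _ le_rfl]
    rw [Fin.mk.injEq] at h1
    obtain rfl : q = q' := by omega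
    rw [mul_right_cancel heq]
  · intro w hw
    rw [mem_parabolicFinset hk] at hw
    obtain ⟨u, q, hq, hu, rfl⟩ := hw.exists_mul_tVee hk
    exact ⟨(u, q), Finset.mem_product.2 ⟨(mem_parabolicFinset hk.le).2 hu,
      Finset.mem_range.2 (by omega)⟩, rfl⟩
  · rintro ⟨w, q⟩ hp
    rw [Finset.mem_product, mem_parabolicFinset hk.le, Finset.mem_range] at hp
    dsimp only at hp ⊢
    obtain ⟨-, h2, h3⟩ := hp.1.mul_tVee hk (q := q) (by omega)
    rw [h2, h3, smul_mul_smul_comm, ← zpow_natCast, ← zpow_add₀ v_ne_zero, Finset.sum_range_succ]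
    congr 2
    rw [Nat.cast_sub (by omega)]
    push_cast
    ring

/-- For the factor with l = J = k the required range is 0 < i < k and the resulting one is 0 < i ≤
k, exactly what the next level needs. -/
theorem bar_parabolicSum {n k : ℕ} (hk : k ≤ n) :
    bar n (parabolicSum n k) = parabolicSum n k ∧
      ∀ i, 1 ≤ i → i < k → parabolicSum n k * genNat n i = v⁻¹ • parabolicSum n k := by
  induction k with
  | zero => rw [parabolicSum_zero, map_one]; exact ⟨rfl, fun i h1 h2 => by omega⟩
  | succ k ih =>
    obtain ⟨h1, h2⟩ := ih (by omega)
    rw [parabolicSum_succ hk]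
    exact ⟨bar_mul_descSum hk le_rfl h1 fun i h3 _ h4 => h2 i h3 h4, fun i h3 h4 =>
      mul_descSum_mul_genNat hk le_rfl (fun i h3 _ h4 => h2 i h3 h4) h3 (by omega) (by omega)⟩

/-! ### Shortest coset representatives -/

theorem simple_mem_parabolicPerp {n k : ℕ} {i : SimpleIdx n} (h : k < i.1) :
    simple i ∈ parabolicPerp n k :=
  Subgroup.subset_closure ⟨i, h, rfl⟩

theorem inv_lt_of_mem_shortestReps {n k : ℕ} {z : Equiv.Perm (Fin n)} (hz : z ∈ shortestReps n k)
    (i : SimpleIdx n) (hi : k < i.1) : z⁻¹ i.lo < z⁻¹ i.hi := by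
  refine (lt_or_gt_of_ne (ne_of_simple z⁻¹ i)).resolve_right fun h => ?_
  have h1 := hz (simple i) (Subgroup.mem_sup_right (simple_mem_parabolicPerp hi))
  have h2 := len_simple_mul_of_gt h
  omega

/-- The position of the `(m+1)`-st `∨` of `z`. -/
def veeElt {n : ℕ} (k : ℕ) (z : Equiv.Perm (Fin n)) (m : Fin (n - k)) : Fin n :=
  z⁻¹ ⟨k + m.1, by omega⟩

/-- Minimality under left multiplication by W_k^⊥ makes z⁻¹ increasing on the places from k on, so
the ∨'s are listed from left to right. -/
theorem strictMono_veeElt {n k : ℕ} {z : Equiv.Perm (Fin n)} (hz : z ∈ shortestReps n k) :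
    StrictMono (veeElt k z) := by
  have hstep : ∀ (a b : Fin (n - k)), a.1 + 1 = b.1 → veeElt k z a < veeElt k z b := by
    intro a b hab
    have := inv_lt_of_mem_shortestReps hz ⟨k + b.1, by omega, by omega⟩ (by dsimp only; omega)
    rwa [show SimpleIdx.lo ⟨k + b.1, _⟩ = (⟨k + a.1, by omega⟩ : Fin n) from
      Fin.ext (by simp only [SimpleIdx.lo]; omega)] at this
  intro a b hab
  obtain ⟨d, hd⟩ := Nat.exists_eq_add_of_lt (Fin.lt_def.1 hab)
  induction d generalizing b with
  | zero => exact hstep a b hd.symm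
  | succ d ih =>
    have hc : a.1 + d + 1 < n - k := by omega
    exact (@ih ⟨a.1 + d + 1, hc⟩ (Fin.lt_def.2 (by dsimp only; omega)) rfl).trans
      (hstep _ b (by dsimp only; omega))

theorem veePos_eq {n k : ℕ} {z : Equiv.Perm (Fin n)} (hz : z ∈ shortestReps n k)
    (m : Fin (n - k)) : veePos k z m = (veeElt k z m).1 + 1 := by
  have h := Finset.orderEmbOfFin_unique (card_veeSet k z) (f := veeElt k z)
    (fun x => by simp [veeSet, veeElt]) (strictMono_veeElt hz)
  rw [veePos, ← h]

theorem le_veeElt {n k : ℕ} {z : Equiv.Perm (Fin n)} (hz : z ∈ shortestReps n k)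
    (m : Fin (n - k)) : m.1 ≤ (veeElt k z m).1 := by
  obtain ⟨m, hm⟩ := m
  induction m with
  | zero => exact Nat.zero_le _
  | succ m ih =>
    have h1 := ih (by omega)
    have h2 := Fin.lt_def.1 (strictMono_veeElt hz
      (show (⟨m, by omega⟩ : Fin (n - k)) < ⟨m + 1, hm⟩ from Fin.lt_def.2 (Nat.lt_succ_self m)))
    dsimp only at h1 ⊢
    omega

/-- At least n - k - m - 1 further positions lie to the right of this ∨. The bound keeps the
natural-number subtraction in `veeDist` from truncating. -/
theorem veeElt_le {n k : ℕ} {z : Equiv.Perm (Fin n)} (hz : z ∈ shortestReps n k)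
    (m : Fin (n - k)) : (veeElt k z m).1 ≤ k + m.1 := by
  obtain ⟨d, hd⟩ : ∃ d, m.1 + d + 1 = n - k := ⟨n - k - m.1 - 1, by omega⟩
  suffices h : (veeElt k z m).1 + d + 1 ≤ n by omega
  induction d generalizing m with
  | zero => exact (veeElt k z m).2
  | succ d ih =>
    have h1 := ih ⟨m.1 + 1, by omega⟩ (by dsimp only; omega)
    have h2 := Fin.lt_def.1 (strictMono_veeElt hz
      (show m < (⟨m.1 + 1, by omega⟩ : Fin (n - k)) from Fin.lt_def.2 (Nat.lt_succ_self m.1)))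
    omega

theorem veeDist_eq {n k : ℕ} {z : Equiv.Perm (Fin n)} (hz : z ∈ shortestReps n k)
    (m : Fin (n - k)) : veeDist k z m = k + m.1 - (veeElt k z m).1 := by
  rw [veeDist, veePos_eq hz]
  omega

theorem veeDist_le {n k : ℕ} {z : Equiv.Perm (Fin n)} (hz : z ∈ shortestReps n k)
    (m : Fin (n - k)) : veeDist k z m ≤ k := by
  have := le_veeElt hz m
  rw [veeDist_eq hz]
  omega

theorem antitone_veeDist {n k : ℕ} {z : Equiv.Perm (Fin n)} (hz : z ∈ shortestReps n k) :
    Antitone (veeDist k z) := by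
  intro a b hab
  rw [veeDist_eq hz, veeDist_eq hz]
  obtain ⟨d, hd⟩ := Nat.exists_eq_add_of_le (Fin.le_def.1 hab)
  suffices h : (veeElt k z a).1 + d ≤ (veeElt k z b).1 by omega
  clear hab
  induction d generalizing b with
  | zero => rw [Fin.ext hd]; omega
  | succ d ih =>
    have h1 := @ih ⟨a.1 + d, by omega⟩ rfl
    have h2 := Fin.lt_def.1 (strictMono_veeElt hz
      (show (⟨a.1 + d, by omega⟩ : Fin (n - k)) < b from Fin.lt_def.2 (by dsimp only; omega)))
    omega

/-- The last factor acts first. It moves the last position p to its target, which the earlier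
factors fix, and it leaves the smaller positions untouched. -/
theorem prod_tVee_apply {n k m : ℕ} (hkm : k + m ≤ n) (p : Fin m → Fin n) (hp : StrictMono p)
    (hle : ∀ i, (p i).1 ≤ k + i.1) (i : Fin m) :
    ((List.ofFn fun i => tVee n (k + i.1 + 1) (k + i.1 - (p i).1)).prod (p i)).1 = k + i.1 := by
  induction m with
  | zero => exact i.elim0
  | succ m ih =>
    rw [List.ofFn_succ', List.prod_concat, Equiv.Perm.mul_apply]
    simp only [Fin.val_castSucc, Fin.val_last]
    have hlast := hle (Fin.last m)
    rw [Fin.val_last] at hlast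
    induction i using Fin.lastCases with
    | last =>
      rw [tVee_apply_eq (show k + m < n by omega) (by omega)]
      have h1 := ((fixesFrom_one k).mul_prod_tVee
        (show k + m ≤ n by omega) (fun i => k + i.1 - (p i.castSucc).1) fun i => by omega).1
      rw [one_mul] at h1
      rw [h1 _ le_rfl, Fin.val_last]
    | cast i =>
      have hlt := Fin.lt_def.1 (hp (Fin.castSucc_lt_last i))
      rw [tVee_apply_of_lt (by omega), Fin.val_castSucc]
      exact ih (by omega) (fun i => p i.castSucc)
        (fun a b hab => hp (Fin.castSucc_lt_castSucc_iff.2 hab)) (fun i => hle i.castSucc) i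

theorem FixesFrom.mul_tVeeProd {n k : ℕ} (hk : k ≤ n) {w : Equiv.Perm (Fin n)}
    (h : FixesFrom k w) {f : Fin (n - k) → ℕ} (hf : ∀ i, f i ≤ k) :
    len (w * tVeeProd k f) = len w + ∑ i, f i ∧
      stdBasis (w * tVeeProd k f) =
        stdBasis w * (List.ofFn fun i => descProd n (k + i.1) (f i)).prod :=
  (h.mul_prod_tVee (by omega) f fun i => (hf i).trans (Nat.le_add_right _ _)).2

theorem eq_tVeeProd {n k : ℕ} (hk : k ≤ n) {z : Equiv.Perm (Fin n)} (hz : z ∈ shortestReps n k) :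
    z = tVeeProd k (veeDist k z) := by
  set y := tVeeProd k (veeDist k z) with hy
  have hyp : ∀ m, (y (veeElt k z m)).1 = k + m.1 := by
    intro m
    have := prod_tVee_apply (k := k) (m := n - k) (by omega) (veeElt k z) (strictMono_veeElt hz)
      (veeElt_le hz) m
    simpa only [hy, tVeeProd, veeDist_eq hz] using this
  -- Both y and z send the (m+1)-st ∨-position to k + m, so the quotient fixes everything from k on
  -- and lies in W_k.
  have hu : FixesFrom k (z * y⁻¹) := by
    intro x hx
    have h1 : y⁻¹ x = veeElt k z ⟨x.1 - k, by omega⟩ := by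
      rw [Equiv.Perm.inv_eq_iff_eq, Fin.ext_iff, hyp]
      dsimp only
      omega
    have h2 : (⟨k + (x.1 - k), by omega⟩ : Fin n) = x := Fin.ext (by dsimp only; omega)
    rw [Equiv.Perm.mul_apply, h1, veeElt, h2]
    exact z.apply_symm_apply x
  have hzu : z * y⁻¹ * y = z := inv_mul_cancel_right z y
  have h1 := (hu.mul_tVeeProd hk (veeDist_le hz)).1
  have h2 := ((fixesFrom_one k).mul_tVeeProd hk
    (veeDist_le hz)).1
  rw [← hy, hzu] at h1
  rw [← hy, one_mul, len_one] at h2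
  -- Minimality gives ℓ(z) ≤ ℓ(y), whereas additivity gives ℓ(z) = ℓ(z y⁻¹) + ℓ(y).
  have h3 := hz (z * y⁻¹)⁻¹ (Subgroup.mem_sup_left (inv_mem (hu.mem_parabolic hk)))
  rw [mul_inv_rev, inv_inv, inv_mul_cancel_right] at h3
  have h4 := eq_one_of_len_eq_zero (w := z * y⁻¹) (by omega)
  rw [h4, one_mul] at hzu
  exact hzu.symm

/-! ### The Kazhdan–Lusztig element -/

theorem smul_prod_ofFn {n m : ℕ} (c : Fin m → K) (x : Fin m → Hecke n) :
    (List.ofFn fun i => c i • x i).prod = (∏ i, c i) • (List.ofFn x).prod := by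
  simpa using (MultilinearMap.mkPiAlgebraFin K m (Hecke n)).map_smul_univ c x

theorem prod_descSum {n k m : ℕ} (a : Fin m → ℕ) :
    (List.ofFn fun i => descSum n (k + i.1) (a i)).prod =
      ∑ f ∈ Fintype.piFinset fun i => Finset.range (a i + 1),
        v ^ ((∑ i, (a i : ℤ)) - ∑ i, (f i : ℤ)) •
          (List.ofFn fun i => descProd n (k + i.1) (f i)).prod := by
  have h := (MultilinearMap.mkPiAlgebraFin K m (Hecke n)).map_sum_finset
    (fun (i : Fin m) (q : ℕ) => v ^ (a i - q) • descProd n (k + i.1) q)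
    (fun i => Finset.range (a i + 1))
  simp only [MultilinearMap.mkPiAlgebraFin_apply] at h
  refine h.trans (Finset.sum_congr rfl fun f hf => ?_)
  rw [smul_prod_ofFn, Finset.prod_pow_eq_pow_sum, ← zpow_natCast]
  congr 2
  rw [Nat.cast_sum, ← Finset.sum_sub_distrib]
  refine Finset.sum_congr rfl fun i _ => ?_
  have := Finset.mem_range.1 (Fintype.mem_piFinset.1 hf i)
  rw [Nat.cast_sub (by omega)]

theorem len_longest_mul {n k : ℕ} (hk : k ≤ n) {wk z : Equiv.Perm (Fin n)}
    (hwk : IsLongest k wk) (hz : z ∈ shortestReps n k) :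
    len (wk * z) = ∑ i ∈ Finset.range k, i + ∑ i, veeDist k z i := by
  conv_lhs => rw [eq_tVeeProd hk hz]
  rw [((fixesFrom_of_mem_parabolic hwk.1).mul_tVeeProd hk (veeDist_le hz)).1, (hwk.len_eq hk).1]

theorem parabolicSum_mul_prod_descSum {n k : ℕ} (hk : k ≤ n) {wk z : Equiv.Perm (Fin n)}
    (hwk : IsLongest k wk) (hz : z ∈ shortestReps n k) :
    parabolicSum n k * (List.ofFn fun i => descSum n (k + i.1) (veeDist k z i)).prod =
      ∑ w' ∈ parabolicFinset n k,
        ∑ i ∈ Fintype.piFinset fun m : Fin (n - k) => Finset.range (veeDist k z m + 1),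
          v ^ ((len (wk * z) : ℤ) - (len w' : ℤ) - ∑ m, (i m : ℤ)) •
            stdBasis (w' * tVeeProd k i) := by
  rw [parabolicSum, prod_descSum, Finset.sum_mul_sum]
  refine Finset.sum_congr rfl fun w' hw' => Finset.sum_congr rfl fun f hf => ?_
  have hf' : ∀ i, f i ≤ k := fun i => by
    have h1 := Finset.mem_range.1 (Fintype.mem_piFinset.1 hf i)
    have h2 := veeDist_le hz i
    omega
  rw [(((mem_parabolicFinset hk).1 hw').mul_tVeeProd hk hf').2, smul_mul_smul_comm,
    ← zpow_add₀ v_ne_zero, len_longest_mul hk hwk hz]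
  congr 2
  push_cast
  ring

theorem klBasis_longest_mul {n k : ℕ} (hk : k ≤ n) {wk z : Equiv.Perm (Fin n)}
    (hwk : IsLongest k wk) (hz : z ∈ shortestReps n k) :
    klBasis (wk * z) =
      ∑ w' ∈ parabolicFinset n k,
        ∑ i ∈ Fintype.piFinset fun m : Fin (n - k) => Finset.range (veeDist k z m + 1),
          v ^ ((len (wk * z) : ℤ) - (len w' : ℤ) - ∑ m, (i m : ℤ)) •
            stdBasis (w' * tVeeProd k i) := by
  obtain ⟨hlen, hlt⟩ := hwk.len_eq hk
  have htop := len_longest_mul hk hwk hz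
  refine klBasis_eq_of_bar_eq ?_ fun y => ?_
  · rw [← parabolicSum_mul_prod_descSum hk hwk hz]
    obtain ⟨h1, h2⟩ := bar_parabolicSum hk
    exact (mul_prod_descSum (by omega) h1 h2 _ (antitone_veeDist hz) (veeDist_le hz)).1
  -- The top term is split off. Since v ℤ[v] is closed under addition, the permutations in the
  -- remaining terms need not be shown distinct.
  · rw [← Finset.sum_product', ← Finset.add_sum_erase _ _ (a := (wk, veeDist k z))]
    · have hterm : v ^ ((len (wk * z) : ℤ) - (len wk : ℤ) - ∑ m, (veeDist k z m : ℤ)) •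
          stdBasis (wk * tVeeProd k (veeDist k z)) = stdBasis (wk * z) := by
        rw [← eq_tVeeProd hk hz, htop, hlen]
        push_cast
        rw [add_sub_cancel_left, sub_self, zpow_zero, one_smul]
      dsimp only
      rw [hterm, add_sub_cancel_left, map_sum]
      refine sum_mem fun p hp => ?_
      obtain ⟨hne, hp⟩ := Finset.mem_erase.1 hp
      obtain ⟨w', f⟩ := p
      obtain ⟨hw', hf⟩ := Finset.mem_product.1 hp
      rw [mem_parabolicFinset hk] at hw'
      have hf' : ∀ i, f i ≤ veeDist k z i := fun i => by
        have : f i < veeDist k z i + 1 := Finset.mem_range.1 (Fintype.mem_piFinset.1 hf i)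
        omega
      -- Either f is smaller than the ∨-distance sequence somewhere, or w' is not the longest
      -- element; each makes the exponent of v strictly positive.
      have hpos : len w' + ∑ i, f i < len (wk * z) := by
        have hsum := Finset.sum_le_sum fun i (_ : i ∈ Finset.univ) => hf' i
        rw [htop]
        by_cases hww : w' = wk
        · have hfne : f ≠ veeDist k z := fun h => hne (by rw [hww, h])
          obtain ⟨i, hi⟩ := Function.ne_iff.1 hfne
          have := Finset.sum_lt_sum (fun i (_ : i ∈ Finset.univ) => hf' i)
            ⟨i, Finset.mem_univ _, lt_of_le_of_ne (hf' i) hi⟩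
          rw [hww, hlen]
          omega
        · have := hlt w' hw' hww
          omega
      dsimp only
      rw [map_smul, coef_stdBasis, smul_eq_mul]
      split_ifs
      · rw [mul_one]
        refine v_zpow_mem_vIntPoly ?_
        have : ((len w' + ∑ i, f i : ℕ) : ℤ) < (len (wk * z) : ℤ) := Int.ofNat_lt.2 hpos
        push_cast at this
        omega
      · rw [mul_zero]; exact zero_mem _
    · refine Finset.mem_product.2 ⟨(mem_parabolicFinset hk).2 (fixesFrom_of_mem_parabolic hwk.1),
        Fintype.mem_piFinset.2 fun i => Finset.mem_range.2 (Nat.lt_succ_self _)⟩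

end SymHecke

theorem mainTheorem8 (n k : ℕ) (hk : k ≤ n)
    (wk : Equiv.Perm (Fin n)) (hwk : SymHecke.IsLongest k wk)
    (z : Equiv.Perm (Fin n)) (hz : z ∈ SymHecke.shortestReps n k) :
    z = SymHecke.tVeeProd k (SymHecke.veeDist k z) ∧
    SymHecke.klBasis (wk * z) =
      ∑ w' ∈ SymHecke.parabolicFinset n k,
        ∑ i ∈ Fintype.piFinset fun m : Fin (n - k) => Finset.range (SymHecke.veeDist k z m + 1),
          SymHecke.v ^ ((SymHecke.len (wk * z) : ℤ) - (SymHecke.len w' : ℤ) - ∑ m, (i m : ℤ)) •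
            SymHecke.stdBasis (w' * SymHecke.tVeeProd k i) :=
  ⟨SymHecke.eq_tVeeProd hk hz, SymHecke.klBasis_longest_mul hk hwk hz⟩
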